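/- Let $n\ge 2$ and let $\sigma$ be the surface measure on the unit sphere $S^{n-1}\subset\mathbb R^n$. Let $\Delta_\omega=\sum_{i<j}\Omega_{ij}^2$, $\Omega_{ij}=x_i\partial_j-x_j\partial_i$, be the Laplace–Beltrami operator on $S^{n-1}$, and let $\Lambda_\omega=\sqrt{1-\Delta_\omega}$. For $s\in\mathbb R$ let $H^s_\omega=\Lambda_\omega^{-s}L^2(S^{n-1})$ with norm $\|g\|_{H^s_\omega}=\|\Lambda_\omega^{s}g\|_{L^2(S^{n-1})}$ (for $s<0$ its elements are distributions on $S^{n-1}$). Let $\widehat{g\,d\sigma}(x)=\int_{S^{n-1}}e^{-ix\cdot\omega}g(\omega)\,d\sigma(\omega)$, where for a distribution $g$ the integral is the action of $g$ on $\omega\mapsto e^{-ix\cdot\omega}$. For functions $F$ of $x=r\omega\in\mathbb R^n$ the operator $\Lambda_\omega^s$ acts in the variable $\omega$, so that $\|\Lambda_\omega^sF\|_{L^2(\mathbb R^n)}^2=\int_0^\infty\|F(r\,\cdot)\|_{H^s_\omega}^2\,r^{n-1}\,dr$. 1. If $b\in(1,n)$, there are constants $0<c,C<\infty$, depending only on $n$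 and $b$, such that for every $g\in L^2(S^{n-1})$ $$c\,\|g\|_{L^2(S^{n-1})}\le\big\|\Lambda_\omega^{\frac{b-1}{2}}|x|^{-\frac b2}\,\widehat{g\,d\sigma}\big\|_{L^2(\mathbb R^n)}\le C\,\|g\|_{L^2(S^{n-1})}.$$ 2. If $b\in(1,n)$, there is a constant $C<\infty$, depending only on $n$ and $b$, such that for every $s\ge\frac{1-b}{2}$ and every $g\in H^s_\omega$ $$\big\||x|^{-\frac b2}\,\widehat{g\,d\sigma}\big\|_{L^2(\mathbb R^n)}\le C\,\|g\|_{H^s_\omega}.$$ 3. The condition on $b$ is necessary. Let $b\in\mathbb R$. If there is a constant $C<\infty$ such that the upper bound in 1 holds for all $g\in L^2(S^{n-1})$, then $b\in(1,n)$. If for some $s\in\mathbb R$ there is a constant $C<\infty$ such that the inequality in 2 holds for all $g\in L^2(S^{n-1})\cap H^s_\omega$, then $b\in(1,n)$. -/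

import Mathlib

open scoped ENNReal NNReal

noncomputable section

namespace SphereTrace

/-- The unit sphere `S^{n-1}` of `ℝⁿ`. -/
abbrev Sph (n : ℕ) : Type := Metric.sphere (0 : EuclideanSpace ℝ (Fin n)) 1

/-- The surface measure `dσ` on `S^{n-1}` (not normalized: the total mass is `n · |B(0,1)|`). -/
abbrev surf (n : ℕ) : MeasureTheory.Measure (Sph n) :=
  (MeasureTheory.volume : MeasureTheory.Measure (EuclideanSpace ℝ (Fin n))).toSphere

/-- The complex Hilbert space `L²(S^{n-1}, dσ)`. -/
abbrev L2Sph (n : ℕ) : Type := MeasureTheory.Lp ℂ 2 (surf n)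

/-- The rotation field `Ω_{ij} = x_i ∂_j - x_j ∂_i`. It is tangent to every sphere centred at the
origin, so that `Ω_{ij} φ` on `S^{n-1}` depends only on `φ` restricted to `S^{n-1}`. -/
def rot {n : ℕ} (i j : Fin n) (φ : EuclideanSpace ℝ (Fin n) → ℂ)
    (x : EuclideanSpace ℝ (Fin n)) : ℂ :=
  (x i : ℂ) * fderiv ℝ φ x (EuclideanSpace.single j 1)
    - (x j : ℂ) * fderiv ℝ φ x (EuclideanSpace.single i 1)

/-- The Laplace-Beltrami operator `Δ_ω = ∑_{i<j} Ω_{ij}²`, on smooth functions. (The smooth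
functions on the sphere are the restrictions of the smooth functions on `ℝⁿ`.) -/
def lapBeltrami {n : ℕ} (φ : EuclideanSpace ℝ (Fin n) → ℂ)
    (x : EuclideanSpace ℝ (Fin n)) : ℂ :=
  ∑ i : Fin n, ∑ j : Fin n, if i < j then rot i j (rot i j φ) x else 0

/-- The `L²` classes of the restrictions to the sphere of `Δ_ω φ + lam φ`, for `φ` smooth. -/
def shiftedRange (n : ℕ) (lam : ℝ) : Set (L2Sph n) :=
  {u | ∃ φ : EuclideanSpace ℝ (Fin n) → ℂ, ContDiff ℝ ((⊤ : ℕ∞) : WithTop ℕ∞) φ ∧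
    ⇑u =ᵐ[surf n] fun ω => lapBeltrami φ (ω : EuclideanSpace ℝ (Fin n)) + (lam : ℂ) * φ ω}

/-- The eigenspace of `-Δ_ω` in `L²(S^{n-1})` for `lam`: all `f ∈ L²` with `-Δ_ω f = lam f` in the
sense of distributions, that is `∫ conj (Δ_ω φ + lam φ) f dσ = 0` for every smooth `φ`. -/
def eigenspace (n : ℕ) (lam : ℝ) : Submodule ℂ (L2Sph n) :=
  (Submodule.span ℂ (shiftedRange n lam))ᗮ

instance (n : ℕ) (lam : ℝ) : (eigenspace n lam).HasOrthogonalProjection :=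
  haveI : CompleteSpace (eigenspace n lam) :=
    (Submodule.isClosed_orthogonal _).completeSpace_coe
  inferInstance

/-- The orthogonal projection `P_lam` of `L²(S^{n-1})` onto the eigenspace of `-Δ_ω`. -/
def proj (n : ℕ) (lam : ℝ) : L2Sph n →L[ℂ] L2Sph n :=
  (eigenspace n lam).starProjection

/-- The domain of `Λ_ω^s`, where `Λ_ω = (1 - Δ_ω)^{1/2}`, as an operator in `L²(S^{n-1})`. -/
def angDomain (n : ℕ) (s : ℝ) : Set (L2Sph n) :=
  {f | Summable fun lam : ℝ≥0 => (1 + (lam : ℝ)) ^ s * ‖proj n lam f‖ ^ 2}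

/-- The operator `Λ_ω^s` with `Λ_ω = (1 - Δ_ω)^{1/2}`, by the functional calculus of `-Δ_ω`, which
has pure point spectrum in `[0, ∞)`: `Λ_ω^s f = ∑_lam (1 + lam)^{s/2} P_lam f`. The value is
meaningful for `f` in `angDomain n s`. -/
def angPow (n : ℕ) (s : ℝ) (f : L2Sph n) : L2Sph n :=
  ∑' lam : ℝ≥0, (((1 + (lam : ℝ)) ^ (s / 2) : ℝ) : ℂ) • proj n lam f

open Classical in
/-- The norm `‖f‖_{H^s_ω} = ‖Λ_ω^s f‖_{L²(S^{n-1})}` of `f ∈ L²(S^{n-1})`, and `∞` outside the domain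
of `Λ_ω^s`. -/
def sobNorm (n : ℕ) (s : ℝ) (f : L2Sph n) : ℝ≥0∞ :=
  if f ∈ angDomain n s then ‖angPow n s f‖ₑ else ⊤

open Classical in
/-- `sobNorm` for a function on the sphere; it is `∞` if the function is not in `L²`. -/
def sobNormFun (n : ℕ) (s : ℝ) (f : Sph n → ℂ) : ℝ≥0∞ :=
  if hf : MeasureTheory.MemLp f 2 (surf n) then sobNorm n s (hf.toLp f) else ⊤

/-- The norm `‖Λ_ω^s F‖_{L²(ℝⁿ)}`, where `Λ_ω` acts in the angular variable of `x = r ω`; in polar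
coordinates its square is `∫_0^∞ ‖Λ_ω^s F(r ·)‖²_{L²(S^{n-1})} r^{n-1} dr`. -/
def angL2Norm (n : ℕ) (s : ℝ) (F : EuclideanSpace ℝ (Fin n) → ℂ) : ℝ≥0∞ :=
  (∫⁻ r in Set.Ioi (0 : ℝ),
    sobNormFun n s (fun ω => F (r • (ω : EuclideanSpace ℝ (Fin n)))) ^ 2
      * ENNReal.ofReal (r ^ (n - 1))) ^ (1 / 2 : ℝ)

/-- The plane wave `e_x(ω) = e^{-i x·ω}` on the sphere. -/
def planeWave {n : ℕ} (x : EuclideanSpace ℝ (Fin n)) (ω : Sph n) : ℂ :=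
  Complex.exp (-(Complex.I * ((inner ℝ x (ω : EuclideanSpace ℝ (Fin n)) : ℝ) : ℂ)))

/-- The plane wave is continuous on the sphere, hence in `L²`. -/
theorem memLp_planeWave {n : ℕ} (x : EuclideanSpace ℝ (Fin n)) :
    MeasureTheory.MemLp (planeWave x) 2 (surf n) := by
  have hc : Continuous (planeWave x) := by
    unfold planeWave
    fun_prop
  refine MeasureTheory.MemLp.of_bound hc.aestronglyMeasurable 1 (Filter.Eventually.of_forall ?_)
  intro ω
  rw [planeWave, Complex.norm_exp]
  simp

/-- The plane wave as an element of `L²(S^{n-1})`. -/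
def planeWaveL2 {n : ℕ} (x : EuclideanSpace ℝ (Fin n)) : L2Sph n :=
  (memLp_planeWave x).toLp (planeWave x)

/-- The Fourier transform of the measure `g dσ`: `x ↦ ∫ e^{-i x·ω} g(ω) dσ(ω)`. -/
def fourierSurf {n : ℕ} (g : L2Sph n) (x : EuclideanSpace ℝ (Fin n)) : ℂ :=
  ∫ ω, planeWave x ω * g ω ∂(surf n)

/-- The Fourier transform of `g dσ` for the general element `g = Λ_ω^{-s} h`, `h ∈ L²(S^{n-1})`, of
`H^s_ω = Λ_ω^{-s} L²_ω`. For `s < 0` this `g` is a distribution on the sphere, and it acts on a smooth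
function `φ` as `∫ h Λ_ω^{-s} φ dσ`; the Fourier transform at `x` is its action on `e_x`. -/
def fourierSurfSob {n : ℕ} (s : ℝ) (h : L2Sph n) (x : EuclideanSpace ℝ (Fin n)) : ℂ :=
  ∫ ω, (angPow n (-s) (planeWaveL2 x)) ω * h ω ∂(surf n)

/-- The function `|x|^{-b/2} G(x)`. -/
def weighted {n : ℕ} (b : ℝ) (G : EuclideanSpace ℝ (Fin n) → ℂ)
    (x : EuclideanSpace ℝ (Fin n)) : ℂ :=
  ((‖x‖ ^ (-b / 2) : ℝ) : ℂ) * G x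

end SphereTrace

end

noncomputable section

namespace SphereTrace

open MeasureTheory Filter Set Topology

/-! Everything is diagonal in spherical harmonics. If `Y` is a harmonic of degree `k`, the Fourier
transform of `Y dσ` at `rθ` is `|S^{n-1}| (-i)^k B_k(r) Y(θ)`, where `B_k` (`radialBessel`) is a
constant multiple of `r^{1-n/2} J_{k+n/2-1}(r)`; this is `integral_planeWave_mul`, and
`proj_fourierSph` for general `g`. Parseval on each sphere and Tonelli in `r` give
(`angL2Norm_weighted_sq`) that the square of the norm is `|S^{n-1}|² ∑_k (1 + λ_k)^s A_k ‖P_k g‖²`,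
with `λ_k = k(k+n-2)` and `A_k = ∫_0^∞ r^{n-1-b} B_k(r)² dr`. Both estimates therefore reduce to the
two-sided bound `A_k ≍ (1 + λ_k)^{-(b-1)/2}` of `exists_besselMoment_bounds`.

The moments are compared without evaluating them. The pair `(B_k, B_{k+1})` solves a first-order
system for which the derivative of `r^{n-b} (B_k² + B_{k+1}²)` contains no cross term. Integrating
it over `(0, ∞)` gives `(2k+n-2+b) A_{k+1} = (2k+n-b) A_k`: the boundary term at `0` vanishes
because `b < n`, the one at infinity because `b > 1`. So `A_k / A_0` is a quotient of Pochhammer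
products, and Euler's limit for the Gamma function gives `A_k ~ const · k^{1-b}`.

Decay at infinity comes from the energy `r^{n-1} (B_k² + B_{k+1}²)`, which a Gronwall argument keeps
between positive constants for large `r` when `k = 0`, and bounded for every `k`
(`besselEnergy_bounds`). The same two-sided control gives necessity: finiteness of `A_0` near `0`
forces `b < n`, and finiteness of `A_0 + A_1` near infinity forces `b > 1`. The test functions are a
constant and a coordinate function.

On the spectral side, `x_i Y` splits on the sphere into harmonics of degrees `k + 1` and `k - 1`
(`IsSolidHarmonic.raise`). This one identity yields the completeness of the harmonics, through
Stone-Weierstrass, and the Funk-Hecke formula, by induction on the power of `θ·ω`. For distributions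
`g = Λ_ω^{-s} h` the estimate passes to the limit from spectral truncations by Fatou's lemma. -/

/-! ### Radial profiles: power series, derivatives and recurrences. -/

/-- The reciprocal `1 / (n/2)_k` of the Pochhammer symbol. -/
def recPoch (n k : ℕ) : ℝ := ∏ i ∈ Finset.range k, ((n : ℝ) / 2 + i)⁻¹

theorem recPoch_zero (n : ℕ) : recPoch n 0 = 1 := by simp [recPoch]

theorem recPoch_nonneg (n k : ℕ) : 0 ≤ recPoch n k :=
  Finset.prod_nonneg fun i _ => by positivity

/-- Every factor `n/2 + i` is at least `1` because `n ≥ 2`; the series below are thus dominated by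
exponential series. -/
theorem recPoch_le_one {n : ℕ} (hn : 2 ≤ n) (k : ℕ) : recPoch n k ≤ 1 := by
  have hn' : (2 : ℝ) ≤ n := by exact_mod_cast hn
  refine Finset.prod_le_one (fun i _ => by positivity) fun i _ => ?_
  apply inv_le_one_of_one_le₀
  have : (0 : ℝ) ≤ i := i.cast_nonneg
  linarith

theorem recPoch_succ {n : ℕ} (hn : 2 ≤ n) (k : ℕ) :
    recPoch n k = ((n : ℝ) / 2 + k) * recPoch n (k + 1) := by
  have hn' : (2 : ℝ) ≤ n := by exact_mod_cast hn
  have : (n : ℝ) / 2 + k ≠ 0 := by positivity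
  rw [recPoch, recPoch, Finset.prod_range_succ]
  field_simp

/-- The entire function `∑ z^m / (m! (n/2)_{k+m})`. -/
def besselSeries (n k : ℕ) (z : ℝ) : ℝ :=
  ∑' m : ℕ, z ^ m / m.factorial * recPoch n (k + m)

theorem norm_besselSeries_term_le {n : ℕ} (hn : 2 ≤ n) (k : ℕ) (z : ℝ) (m : ℕ) :
    ‖z ^ m / m.factorial * recPoch n (k + m)‖ ≤ ‖z‖ ^ m / m.factorial := by
  rw [norm_mul, norm_div, norm_pow, Real.norm_of_nonneg (recPoch_nonneg _ _)]
  rw [Real.norm_natCast]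
  exact mul_le_of_le_one_right (by positivity) (recPoch_le_one hn _)

theorem summable_besselSeries {n : ℕ} (hn : 2 ≤ n) (k : ℕ) (z : ℝ) :
    Summable fun m : ℕ => z ^ m / m.factorial * recPoch n (k + m) :=
  .of_norm_bounded (Real.summable_pow_div_factorial ‖z‖) (norm_besselSeries_term_le hn k z)

/-- Differentiation lowers `m` by one, and the Pochhammer index `k + m` is kept by raising `k`.
Termwise differentiation is legitimate on a ball containing `z`, where `m R^{m-1}/m!` dominates. -/
theorem hasDerivAt_besselSeries {n : ℕ} (hn : 2 ≤ n) (k : ℕ) (z : ℝ) :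
    HasDerivAt (besselSeries n k) (besselSeries n (k + 1) z) z := by
  set R : ℝ := ‖z‖ + 1
  have hR : 0 ≤ R := by positivity
  have hu : Summable fun m : ℕ => (m : ℝ) * R ^ (m - 1) / m.factorial := by
    rw [← summable_nat_add_iff 1]
    refine (Real.summable_pow_div_factorial R).congr fun m => ?_
    rw [Nat.factorial_succ]
    push_cast
    have : (m : ℝ) + 1 ≠ 0 := by positivity
    field_simp
  have key := hasDerivAt_tsum_of_isPreconnected (𝕜 := ℝ)
    (g := fun m y => y ^ m / m.factorial * recPoch n (k + m))
    (g' := fun m y => (m : ℝ) * y ^ (m - 1) / m.factorial * recPoch n (k + m))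
    (t := Metric.ball 0 R) (y₀ := z) (y := z) hu Metric.isOpen_ball
    (convex_ball _ _).isPreconnected
    (fun m y _ => ((hasDerivAt_pow m y).div_const _).mul_const _)
    (fun m y hy => by
      have hy' : ‖y‖ ≤ R := by simpa using (mem_ball_zero_iff.1 hy).le
      rw [norm_mul, norm_div, norm_mul, norm_pow, Real.norm_of_nonneg (recPoch_nonneg _ _),
        Real.norm_natCast, Real.norm_natCast]
      refine (mul_le_of_le_one_right (by positivity) (recPoch_le_one hn _)).trans ?_
      gcongr)
    (by simp [R]) (summable_besselSeries hn k z) (by simp [R])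
  refine key.congr_deriv ?_
  have hs : Summable fun m : ℕ => (m : ℝ) * z ^ (m - 1) / m.factorial * recPoch n (k + m) := by
    rw [← summable_nat_add_iff 1]
    refine (summable_besselSeries hn (k + 1) z).congr fun m => ?_
    rw [Nat.factorial_succ, show k + 1 + m = k + (m + 1) by ring]
    push_cast
    have : (m : ℝ) + 1 ≠ 0 := by positivity
    field_simp
  rw [hs.tsum_eq_zero_add, besselSeries]
  simp only [Nat.cast_zero, zero_mul, zero_div, zero_add]
  refine tsum_congr fun m => ?_
  rw [Nat.factorial_succ, show k + 1 + m = k + (m + 1) by ring]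
  push_cast
  have : (m : ℝ) + 1 ≠ 0 := by positivity
  field_simp

/-- Write `1/(n/2)_{k+m} = (n/2 + k + m)/(n/2)_{k+m+1}` and split the numerator: the summand `m`
cancels against `m!` and produces the factor `z` and another shift of `k`. -/
theorem besselSeries_recurrence {n : ℕ} (hn : 2 ≤ n) (k : ℕ) (z : ℝ) :
    besselSeries n k z =
      z * besselSeries n (k + 2) z + ((n : ℝ) / 2 + k) * besselSeries n (k + 1) z := by
  have h1 := (summable_besselSeries hn (k + 2) z).hasSum.mul_left z
  have h2 := (summable_besselSeries hn (k + 1) z).hasSum.mul_left ((n : ℝ) / 2 + k)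
  have h3 : HasSum (fun m : ℕ => (m : ℝ) * (z ^ m / m.factorial * recPoch n (k + 1 + m)))
      (z * besselSeries n (k + 2) z) := by
    rw [← hasSum_nat_add_iff' 1, Finset.sum_range_one, Nat.cast_zero, zero_mul, sub_zero]
    refine (congrArg (HasSum · _) (funext fun m => ?_)).mp h1
    rw [Nat.factorial_succ, show k + 1 + (m + 1) = k + 2 + m by ring]
    push_cast
    have : (m : ℝ) + 1 ≠ 0 := by positivity
    field_simp
    ring
  rw [besselSeries]
  refine HasSum.tsum_eq ((congrArg (HasSum · _) (funext fun m => ?_)).mp (h3.add h2))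
  rw [recPoch_succ hn (k + m), show k + 1 + m = k + m + 1 by ring]
  push_cast
  ring

theorem besselSeries_apply_zero (n k : ℕ) : besselSeries n k 0 = recPoch n k := by
  rw [besselSeries, tsum_eq_single 0]
  · simp
  · intro m hm; simp [hm]

/-- The radial profile of the Fourier transform of a spherical harmonic of degree `k`: up to a
constant it is `r^{1-n/2} J_{k+n/2-1}(r)`. -/
def radialBessel (n k : ℕ) (r : ℝ) : ℝ := (r / 2) ^ k * besselSeries n k (-(r ^ 2 / 4))

theorem hasDerivAt_radialBessel {n : ℕ} (hn : 2 ≤ n) (k : ℕ) {r : ℝ} (hr : r ≠ 0) :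
    HasDerivAt (radialBessel n k) (k / r * radialBessel n k r - radialBessel n (k + 1) r) r := by
  have h1 : HasDerivAt (fun r : ℝ => -(r ^ 2 / 4)) (-(r / 2)) r := by
    refine (((hasDerivAt_pow 2 r).div_const 4).neg).congr_deriv ?_
    push_cast; ring
  have h2 := (hasDerivAt_besselSeries hn k (-(r ^ 2 / 4))).comp r h1
  have h3 : HasDerivAt (fun r : ℝ => (r / 2) ^ k) (k * (r / 2) ^ (k - 1) * (1 / 2)) r :=
    ((hasDerivAt_id r).div_const 2).pow k
  refine (h3.mul h2).congr_deriv ?_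
  simp only [radialBessel, Function.comp_apply]
  rcases k with _ | k
  · simp; ring
  · rw [Nat.add_sub_cancel]; push_cast; field_simp; ring

theorem radialBessel_recurrence {n : ℕ} (hn : 2 ≤ n) (k : ℕ) {r : ℝ} (hr : r ≠ 0) :
    radialBessel n k r + radialBessel n (k + 2) r = (2 * k + n) / r * radialBessel n (k + 1) r := by
  simp only [radialBessel]
  rw [besselSeries_recurrence hn k]
  field_simp
  ring

/-- The three-term recurrence eliminates `B_{k+2}`, so that `B_k` and `B_{k+1}` form a closed
first-order system. -/
theorem hasDerivAt_radialBessel_succ {n : ℕ} (hn : 2 ≤ n) (k : ℕ) {r : ℝ} (hr : r ≠ 0) :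
    HasDerivAt (radialBessel n (k + 1))
      (radialBessel n k r - (k + n - 1) / r * radialBessel n (k + 1) r) r := by
  refine (hasDerivAt_radialBessel hn (k + 1) hr).congr_deriv ?_
  have := radialBessel_recurrence hn k hr
  push_cast
  rw [show k + 1 + 1 = k + 2 by rfl]
  linear_combination -this

theorem continuous_radialBessel {n : ℕ} (hn : 2 ≤ n) (k : ℕ) : Continuous (radialBessel n k) := by
  have : Continuous (besselSeries n k) :=
    continuous_iff_continuousAt.2 fun z => (hasDerivAt_besselSeries hn k z).continuousAt
  unfold radialBessel
  fun_prop

theorem radialBessel_zero_zero (n : ℕ) : radialBessel n 0 0 = 1 := by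
  simp [radialBessel, besselSeries_apply_zero, recPoch_zero]

/-! ### Energy estimates for consecutive profiles. -/

/-- The energy `r^{n-1} (B_k² + B_{k+1}²)` of two consecutive radial profiles. -/
def besselEnergy (n k : ℕ) (r : ℝ) : ℝ :=
  r ^ ((n : ℝ) - 1) * (radialBessel n k r ^ 2 + radialBessel n (k + 1) r ^ 2)

/-- The energy with the correction that makes its logarithmic derivative integrable at infinity. -/
def besselModEnergy (n k : ℕ) (r : ℝ) : ℝ :=
  besselEnergy n k r -
    (2 * k + n - 1) * (r ^ ((n : ℝ) - 2) * (radialBessel n k r * radialBessel n (k + 1) r))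

theorem rpow_split {r : ℝ} (hr : 0 < r) (p : ℝ) : r ^ (p + 1) = r ^ p * r := by
  rw [Real.rpow_add hr, Real.rpow_one]

/-- The terms `∓ 2 B_k B_{k+1}` from the two derivatives cancel. The exponent is left free for three
uses: `p = n - 2` (energy), `p = 2n - 3` (positivity), `p = n - 1 - b` (moments). -/
theorem hasDerivAt_rpow_mul_energy {n : ℕ} (hn : 2 ≤ n) (k : ℕ) (p : ℝ) {r : ℝ} (hr : 0 < r) :
    HasDerivAt
      (fun r => r ^ (p + 1) * (radialBessel n k r ^ 2 + radialBessel n (k + 1) r ^ 2))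
      (r ^ p * ((p + 1 + 2 * k) * radialBessel n k r ^ 2
        - (2 * k + 2 * n - 3 - p) * radialBessel n (k + 1) r ^ 2)) r := by
  have hB := hasDerivAt_radialBessel hn k hr.ne'
  have hC := hasDerivAt_radialBessel_succ hn k hr.ne'
  have hp : HasDerivAt (fun r : ℝ => r ^ (p + 1)) ((p + 1) * r ^ (p + 1 - 1)) r :=
    Real.hasDerivAt_rpow_const (Or.inl hr.ne')
  refine (hp.mul ((hB.pow 2).add (hC.pow 2))).congr_deriv ?_
  rw [add_sub_cancel_right, rpow_split hr]
  simp only [Pi.add_apply, Pi.pow_apply]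
  push_cast
  field_simp
  ring

theorem hasDerivAt_rpow_mul_cross {n : ℕ} (hn : 2 ≤ n) (k : ℕ) (p : ℝ) {r : ℝ} (hr : 0 < r) :
    HasDerivAt
      (fun r => r ^ (p + 1) * (radialBessel n k r * radialBessel n (k + 1) r))
      (r ^ p * ((p + 2 - n) * (radialBessel n k r * radialBessel n (k + 1) r)
        + r * (radialBessel n k r ^ 2 - radialBessel n (k + 1) r ^ 2))) r := by
  have hB := hasDerivAt_radialBessel hn k hr.ne'
  have hC := hasDerivAt_radialBessel_succ hn k hr.ne'
  have hp : HasDerivAt (fun r : ℝ => r ^ (p + 1)) ((p + 1) * r ^ (p + 1 - 1)) r :=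
    Real.hasDerivAt_rpow_const (Or.inl hr.ne')
  refine (hp.mul (hB.mul hC)).congr_deriv ?_
  rw [add_sub_cancel_right, rpow_split hr]
  simp only [Pi.mul_apply]
  field_simp
  ring

/-- The energy has derivative `κ r^{n-2} (B_k² - B_{k+1}²)` with `κ = 2k+n-1`, which relative to the
energy is only `O(1/r)`. The derivative of the correction cancels it and leaves a remainder of
relative size `O(1/r²)`. -/
theorem hasDerivAt_besselModEnergy {n : ℕ} (hn : 2 ≤ n) (k : ℕ) {r : ℝ} (hr : 0 < r) :
    HasDerivAt (besselModEnergy n k)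
      ((2 * k + n - 1) * (r ^ ((n : ℝ) - 3) * (radialBessel n k r * radialBessel n (k + 1) r)))
      r := by
  have h1 := hasDerivAt_rpow_mul_energy hn k ((n : ℝ) - 2) hr
  have h2 := hasDerivAt_rpow_mul_cross hn k ((n : ℝ) - 3) hr
  rw [show (n : ℝ) - 2 + 1 = n - 1 by ring] at h1
  rw [show (n : ℝ) - 3 + 1 = n - 2 by ring] at h2
  refine (h1.sub (h2.const_mul ((2 * k + n - 1 : ℝ)))).congr_deriv ?_
  rw [show (n : ℝ) - 2 = (n - 3) + 1 by ring, rpow_split hr]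
  ring

theorem besselEnergy_eq {n k : ℕ} {r : ℝ} (hr : 0 < r) :
    besselEnergy n k r = r ^ ((n : ℝ) - 3) * r ^ 2 *
      (radialBessel n k r ^ 2 + radialBessel n (k + 1) r ^ 2) := by
  rw [besselEnergy, show (n : ℝ) - 1 = (n - 3 + 1) + 1 by ring, rpow_split hr, rpow_split hr]
  ring

theorem besselEnergy_nonneg (n k : ℕ) {r : ℝ} (hr : 0 < r) : 0 ≤ besselEnergy n k r := by
  unfold besselEnergy; positivity

theorem abs_besselCross_le {n : ℕ} (hn : 2 ≤ n) (k : ℕ) {r : ℝ} (hr : 0 < r) :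
    |(2 * k + n - 1 : ℝ) * (r ^ ((n : ℝ) - 3) * (radialBessel n k r * radialBessel n (k + 1) r))| ≤
      (2 * k + n - 1) / (2 * r ^ 2) * besselEnergy n k r := by
  have hn' : (2 : ℝ) ≤ n := by exact_mod_cast hn
  have hκ : (0 : ℝ) ≤ 2 * k + n - 1 := by linarith [(Nat.cast_nonneg k : (0 : ℝ) ≤ k)]
  have hq : 0 ≤ r ^ ((n : ℝ) - 3) := by positivity
  rw [besselEnergy_eq hr, abs_mul, abs_mul, abs_of_nonneg hκ, abs_of_nonneg hq, abs_mul]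
  have := two_mul_le_add_sq |radialBessel n k r| |radialBessel n (k + 1) r|
  rw [sq_abs, sq_abs] at this
  calc _ ≤ (2 * k + n - 1 : ℝ) * (r ^ ((n : ℝ) - 3) *
        ((radialBessel n k r ^ 2 + radialBessel n (k + 1) r ^ 2) / 2)) := by
        gcongr; linarith
    _ = _ := by field_simp

theorem abs_besselModEnergy_sub_le {n : ℕ} (hn : 2 ≤ n) (k : ℕ) {r : ℝ}
    (hr : 2 * k + n - 1 ≤ r) :
    |besselModEnergy n k r - besselEnergy n k r| ≤ besselEnergy n k r / 2 := by
  have hn' : (2 : ℝ) ≤ n := by exact_mod_cast hn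
  have hκ : (1 : ℝ) ≤ 2 * k + n - 1 := by linarith [(Nat.cast_nonneg k : (0 : ℝ) ≤ k)]
  have hr0 : 0 < r := by linarith
  have h := abs_besselCross_le hn k hr0
  have h2 : |besselModEnergy n k r - besselEnergy n k r| = r *
      |(2 * k + n - 1 : ℝ) *
        (r ^ ((n : ℝ) - 3) * (radialBessel n k r * radialBessel n (k + 1) r))| := by
    rw [besselModEnergy, show (n : ℝ) - 2 = (n - 3) + 1 by ring, rpow_split hr0, sub_sub_cancel_left,
      abs_neg, ← abs_of_pos hr0, ← abs_mul, abs_of_pos hr0]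
    congr 1; ring
  rw [h2]
  calc _ ≤ r * ((2 * k + n - 1) / (2 * r ^ 2) * besselEnergy n k r) := by gcongr
    _ = (2 * k + n - 1) / r * (besselEnergy n k r / 2) := by field_simp
    _ ≤ 1 * (besselEnergy n k r / 2) := by
        have := besselEnergy_nonneg n k hr0
        gcongr
        rwa [div_le_one hr0]
    _ = _ := one_mul _

theorem hasDerivAt_exp_div (c : ℝ) {r : ℝ} (hr : 0 < r) :
    HasDerivAt (fun r => Real.exp (c / r)) (-(c / r ^ 2) * Real.exp (c / r)) r := by
  have := ((hasDerivAt_inv hr.ne').const_mul c).exp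
  simp only [← div_eq_mul_inv] at this
  refine this.congr_deriv ?_
  field_simp

/-- Gronwall on `[κ, ∞)`: there the modified energy `F` is comparable to the energy `E` and `|F'| ≤
(κ/r²) F`, so `F e^{κ/r}` decreases and `F e^{-κ/r}` increases. The constants depend on `k`, which
is harmless: only convergence of integrals is drawn from them. -/
theorem besselEnergy_bounds {n : ℕ} (hn : 2 ≤ n) (k : ℕ) {r : ℝ} (hr : 2 * k + n - 1 ≤ r) :
    besselEnergy n k r ≤ 2 * (besselModEnergy n k (2 * k + n - 1) * Real.exp 1) ∧
    besselEnergy n k (2 * k + n - 1) / 3 * Real.exp (-1) ≤ besselEnergy n k r := by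
  have hn' : (2 : ℝ) ≤ n := by exact_mod_cast hn
  set κ : ℝ := 2 * k + n - 1 with hκdef
  have hκ : (1 : ℝ) ≤ κ := by linarith [(Nat.cast_nonneg k : (0 : ℝ) ≤ k)]
  have hpos : ∀ x ∈ Ici κ, 0 < x := fun x hx => by have := mem_Ici.1 hx; linarith
  have hd : ∀ c : ℝ, ∀ x ∈ Ici κ, HasDerivAt (fun r => besselModEnergy n k r * Real.exp (c / r))
      ((κ * (x ^ ((n : ℝ) - 3) * (radialBessel n k x * radialBessel n (k + 1) x))
        - c / x ^ 2 * besselModEnergy n k x) * Real.exp (c / x)) x := fun c x hx => by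
    refine ((hasDerivAt_besselModEnergy hn k (hpos x hx)).mul
      (hasDerivAt_exp_div c (hpos x hx))).congr_deriv ?_
    ring
  have hle : ∀ x ∈ Ici κ,
      |κ * (x ^ ((n : ℝ) - 3) * (radialBessel n k x * radialBessel n (k + 1) x))| ≤
        κ / x ^ 2 * besselModEnergy n k x := fun x hx => by
    have hx0 := hpos x hx
    have h1 := abs_besselCross_le hn k hx0
    have h2 := abs_le.1 (abs_besselModEnergy_sub_le hn k (mem_Ici.1 hx))
    refine h1.trans ?_
    have : (2 * k + n - 1 : ℝ) / (2 * x ^ 2) * besselEnergy n k x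
        = κ / x ^ 2 * (besselEnergy n k x / 2) := by rw [hκdef]; field_simp
    rw [this]
    gcongr
    linarith
  have hanti : AntitoneOn (fun r => besselModEnergy n k r * Real.exp (κ / r)) (Ici κ) := by
    refine antitoneOn_of_deriv_nonpos (convex_Ici κ)
      (fun x hx => (hd κ x hx).continuousAt.continuousWithinAt)
      (fun x hx => (hd κ x (interior_subset hx)).differentiableAt.differentiableWithinAt)
      fun x hx => ?_
    rw [(hd κ x (interior_subset hx)).deriv]
    refine mul_nonpos_of_nonpos_of_nonneg ?_ (Real.exp_nonneg _)
    linarith [(abs_le.1 (hle x (interior_subset hx))).2]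
  have hmono : MonotoneOn (fun r => besselModEnergy n k r * Real.exp (-κ / r)) (Ici κ) := by
    refine monotoneOn_of_deriv_nonneg (convex_Ici κ)
      (fun x hx => (hd (-κ) x hx).continuousAt.continuousWithinAt)
      (fun x hx => (hd (-κ) x (interior_subset hx)).differentiableAt.differentiableWithinAt)
      fun x hx => ?_
    rw [(hd (-κ) x (interior_subset hx)).deriv]
    refine mul_nonneg ?_ (Real.exp_nonneg _)
    have := (abs_le.1 (hle x (interior_subset hx))).1
    rw [neg_div, neg_mul]
    linarith
  have hr0 : 0 < r := by linarith
  have hκ0 : κ ≠ 0 := by positivity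
  have a1 := hanti (mem_Ici.2 le_rfl) (mem_Ici.2 hr) hr
  have a2 := hmono (mem_Ici.2 le_rfl) (mem_Ici.2 hr) hr
  simp only [neg_div, div_self hκ0] at a1 a2
  have b1 := abs_le.1 (abs_besselModEnergy_sub_le hn k hr)
  have b2 := abs_le.1 (abs_besselModEnergy_sub_le hn k (le_refl κ))
  have e1 := besselEnergy_nonneg n k hr0
  have e2 := besselEnergy_nonneg n k (r := κ) (by linarith)
  have F1 : 0 ≤ besselModEnergy n k r := by linarith
  have c1 : 1 ≤ Real.exp (κ / r) := Real.one_le_exp (by positivity)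
  have c2 : Real.exp (-(κ / r)) ≤ 1 := Real.exp_le_one_iff.2 (by simp; positivity)
  constructor
  -- Here `E ≤ 2F`, and `F(r) ≤ F(r) e^{κ/r} ≤ F(κ) e`.
  · nlinarith [mul_le_mul_of_nonneg_left c1 F1]
  -- The factor `1/3` is `(2/3)(1/2)`: `E(r) ≥ (2/3) F(r)` and `F(κ) ≥ E(κ)/2`.
  · have h1 : besselModEnergy n k κ * Real.exp (-1) ≤ besselModEnergy n k r :=
      a2.trans (mul_le_of_le_one_right F1 c2)
    have h2 : besselEnergy n k κ / 2 * Real.exp (-1) ≤ besselModEnergy n k κ * Real.exp (-1) := by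
      gcongr; linarith
    have : besselEnergy n k κ / 3 * Real.exp (-1)
      = 2 / 3 * (besselEnergy n k κ / 2 * Real.exp (-1)) := by ring
    rw [this]
    linarith

/-- The exponent `p = 2n - 3` removes the `B_1²` term from the derivative, so `r^{2n-2} (B_0² +
B_1²)` is nondecreasing; it is positive near `0` because `B_0(0) = 1`. This makes the lower energy
bound nontrivial. -/
theorem besselEnergy_zero_pos {n : ℕ} (hn : 2 ≤ n) {R : ℝ} (hR : 0 < R) :
    0 < besselEnergy n 0 R := by
  have hn' : (2 : ℝ) ≤ n := by exact_mod_cast hn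
  set p : ℝ := 2 * n - 3
  have hd := fun x (hx : x ∈ Ioi (0 : ℝ)) => hasDerivAt_rpow_mul_energy hn 0 p (mem_Ioi.1 hx)
  have hmono : MonotoneOn (fun r => r ^ (p + 1) *
      (radialBessel n 0 r ^ 2 + radialBessel n (0 + 1) r ^ 2)) (Ioi 0) := by
    refine monotoneOn_of_deriv_nonneg (convex_Ioi 0)
      (fun x hx => (hd x hx).continuousAt.continuousWithinAt)
      (fun x hx => (hd x (interior_subset hx)).differentiableAt.differentiableWithinAt)
      fun x hx => ?_
    have hx0 : 0 < x := mem_Ioi.1 (interior_subset hx)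
    rw [(hd x (interior_subset hx)).deriv]
    have h1 : (0 : ℝ) ≤ p + 1 + 2 * (0 : ℕ) := by simp only [p]; push_cast; linarith
    have h2 : (2 * (0 : ℕ) + 2 * n - 3 - p : ℝ) = 0 := by simp [p]
    rw [h2, zero_mul, sub_zero]
    positivity
  have hc := (continuous_radialBessel hn 0).continuousAt (x := (0 : ℝ))
  have hev : ∀ᶠ x in 𝓝[>] (0 : ℝ), 0 < radialBessel n 0 x := by
    refine (hc.eventually (lt_mem_nhds ?_)).filter_mono nhdsWithin_le_nhds
    rw [radialBessel_zero_zero]; exact one_pos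
  obtain ⟨x, hx, hxR⟩ := (hev.and (Ioo_mem_nhdsGT hR)).exists
  have h := hmono (mem_Ioi.2 hxR.1) (mem_Ioi.2 hR) hxR.2.le
  have hx0 : 0 < x := hxR.1
  have hpos : 0 < x ^ (p + 1) * (radialBessel n 0 x ^ 2 + radialBessel n (0 + 1) x ^ 2) := by
    positivity
  have h3 := hpos.trans_le h
  have h4 : 0 < radialBessel n 0 R ^ 2 + radialBessel n (0 + 1) R ^ 2 :=
    pos_of_mul_pos_right h3 (by positivity)
  unfold besselEnergy
  positivity

/-! ### Weighted moments of the profiles. -/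

/-- The moment `∫_0^∞ r^{n-1-b} B_k(r)² dr`. -/
def besselMoment (n : ℕ) (b : ℝ) (k : ℕ) : ℝ≥0∞ :=
  ∫⁻ r in Ioi (0 : ℝ), ENNReal.ofReal (r ^ ((n : ℝ) - 1 - b) * radialBessel n k r ^ 2)

theorem measurable_besselMoment_integrand {n : ℕ} (hn : 2 ≤ n) (b : ℝ) (k : ℕ) :
    Measurable fun r : ℝ => r ^ ((n : ℝ) - 1 - b) * radialBessel n k r ^ 2 :=
  (measurable_id.pow_const _).mul ((continuous_radialBessel hn k).measurable.pow_const 2)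

/-- Near `0` the exponent exceeds `-1` because `b < n`; beyond `κ` the energy bound dominates the
integrand by a multiple of `r^{-b}`, integrable because `b > 1`. -/
theorem integrableOn_besselMoment {n : ℕ} (hn : 2 ≤ n) {b : ℝ} (hb1 : 1 < b) (hbn : b < n) (k : ℕ) :
    IntegrableOn (fun r : ℝ => r ^ ((n : ℝ) - 1 - b) * radialBessel n k r ^ 2) (Ioi 0) := by
  have hn' : (2 : ℝ) ≤ n := by exact_mod_cast hn
  set κ : ℝ := 2 * k + n - 1 with hκdef
  have hκ : (1 : ℝ) ≤ κ := by linarith [(Nat.cast_nonneg k : (0 : ℝ) ≤ k)]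
  have hκ0 : 0 < κ := by linarith
  rw [← Ioc_union_Ioi_eq_Ioi hκ0.le]
  refine IntegrableOn.union ?_ ?_
  · rw [← integrableOn_Icc_iff_integrableOn_Ioc]
    refine IntegrableOn.mul_continuousOn ?_
      ((continuous_radialBessel hn k).pow 2).continuousOn isCompact_Icc
    rw [integrableOn_Icc_iff_integrableOn_Ioc,
      ← intervalIntegrable_iff_integrableOn_Ioc_of_le hκ0.le]
    exact intervalIntegral.intervalIntegrable_rpow' (by linarith)
  · have hi := (integrableOn_Ioi_rpow_of_lt (neg_lt_neg hb1) hκ0).const_mul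
      (2 * (besselModEnergy n k κ * Real.exp 1))
    refine hi.mono' (measurable_besselMoment_integrand hn b k).aestronglyMeasurable ?_
    filter_upwards [ae_restrict_mem measurableSet_Ioi] with r hr
    have hr0 : 0 < r := hκ0.trans (mem_Ioi.1 hr)
    rw [Real.norm_of_nonneg (by positivity)]
    have h := (besselEnergy_bounds hn k (mem_Ioi.1 hr).le).1
    rw [← hκdef] at h
    calc r ^ ((n : ℝ) - 1 - b) * radialBessel n k r ^ 2
        ≤ r ^ ((n : ℝ) - 1 - b) *
          (radialBessel n k r ^ 2 + radialBessel n (k + 1) r ^ 2) := by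
          gcongr
          linarith [sq_nonneg (radialBessel n (k + 1) r)]
      _ = besselEnergy n k r * r ^ (-b) := by
          rw [besselEnergy, sub_eq_add_neg ((n : ℝ) - 1), Real.rpow_add hr0]; ring
      _ ≤ _ := by gcongr

theorem besselMoment_eq_ofReal {n : ℕ} (hn : 2 ≤ n) {b : ℝ} (hb1 : 1 < b) (hbn : b < n) (k : ℕ) :
    besselMoment n b k = ENNReal.ofReal
      (∫ r in Ioi (0 : ℝ), r ^ ((n : ℝ) - 1 - b) * radialBessel n k r ^ 2) := by
  rw [besselMoment, ofReal_integral_eq_lintegral_ofReal (integrableOn_besselMoment hn hb1 hbn k)]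
  filter_upwards [ae_restrict_mem measurableSet_Ioi] with r hr
  have := mem_Ioi.1 hr
  simp only [Pi.zero_apply]
  positivity

/-- The fundamental theorem of calculus for `r^{n-b} (B_k² + B_{k+1}²)` on `(0, ∞)`, whose boundary
values both vanish. -/
theorem besselMoment_recurrence {n : ℕ} (hn : 2 ≤ n) {b : ℝ} (hb1 : 1 < b) (hbn : b < n) (k : ℕ) :
    (∫ r in Ioi (0 : ℝ), r ^ ((n : ℝ) - 1 - b) * radialBessel n (k + 1) r ^ 2) *
        (2 * k + n - 2 + b) =
      (∫ r in Ioi (0 : ℝ), r ^ ((n : ℝ) - 1 - b) * radialBessel n k r ^ 2) *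
        (2 * k + n - b) := by
  have hn' : (2 : ℝ) ≤ n := by exact_mod_cast hn
  have i0 := integrableOn_besselMoment hn hb1 hbn k
  have i1 := integrableOn_besselMoment hn hb1 hbn (k + 1)
  set h : ℝ → ℝ := fun r => r ^ ((n : ℝ) - 1 - b + 1) *
    (radialBessel n k r ^ 2 + radialBessel n (k + 1) r ^ 2)
  have hd := fun x (hx : x ∈ Ioi (0 : ℝ)) =>
    hasDerivAt_rpow_mul_energy hn k ((n : ℝ) - 1 - b) (mem_Ioi.1 hx)
  have hcont : ContinuousWithinAt h (Ici 0) 0 := by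
    refine ContinuousAt.continuousWithinAt (ContinuousAt.mul ?_ ?_)
    · exact Real.continuousAt_rpow_const _ _ (Or.inr (by linarith))
    · exact (((continuous_radialBessel hn k).pow 2).add
        ((continuous_radialBessel hn (k + 1)).pow 2)).continuousAt
  -- At infinity the function is `r^{-(b-1)}` times a bounded energy.
  have htend : Tendsto h atTop (𝓝 0) := by
    have h1 : Tendsto (fun r : ℝ => r ^ (-(b - 1)) *
        (2 * (besselModEnergy n k (2 * k + n - 1) * Real.exp 1))) atTop (𝓝 0) := by
      simpa using (tendsto_rpow_neg_atTop (by linarith : 0 < b - 1)).mul_const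
        (2 * (besselModEnergy n k (2 * k + n - 1) * Real.exp 1))
    refine tendsto_of_tendsto_of_tendsto_of_le_of_le' tendsto_const_nhds h1 ?_ ?_
    · filter_upwards [eventually_gt_atTop 0] with r hr
      simp only [h]
      positivity
    · filter_upwards [eventually_gt_atTop 0, eventually_ge_atTop (2 * k + n - 1 : ℝ)] with r hr hr'
      have := (besselEnergy_bounds hn k hr').1
      calc h r = r ^ (-(b - 1)) * besselEnergy n k r := by
            simp only [h, besselEnergy]
            rw [show (n : ℝ) - 1 - b + 1 = -(b - 1) + (n - 1) by ring, Real.rpow_add hr]; ring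
        _ ≤ _ := by gcongr
  have hint : ∀ r : ℝ, r ^ ((n : ℝ) - 1 - b) * (((n : ℝ) - 1 - b + 1 + 2 * k) *
      radialBessel n k r ^ 2
        - (2 * k + 2 * n - 3 - ((n : ℝ) - 1 - b)) * radialBessel n (k + 1) r ^ 2) =
      ((n : ℝ) - 1 - b + 1 + 2 * k) * (r ^ ((n : ℝ) - 1 - b) * radialBessel n k r ^ 2) -
      (2 * k + 2 * n - 3 - ((n : ℝ) - 1 - b)) *
        (r ^ ((n : ℝ) - 1 - b) * radialBessel n (k + 1) r ^ 2) := fun r => by ring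
  simp only [hint] at hd
  have key := integral_Ioi_of_hasDerivAt_of_tendsto hcont hd
    ((i0.const_mul _).sub (i1.const_mul _)) htend
  rw [integral_sub (i0.const_mul _) (i1.const_mul _), integral_const_mul, integral_const_mul] at key
  have h0 : h 0 = 0 := by
    simp only [h]
    rw [Real.zero_rpow (by linarith), zero_mul]
  rw [h0] at key
  linear_combination -key

theorem integrableOn_of_besselMoment_ne_top {n : ℕ} (hn : 2 ≤ n) {b : ℝ} {k : ℕ}
    (h : besselMoment n b k ≠ ⊤) :
    IntegrableOn (fun r : ℝ => r ^ ((n : ℝ) - 1 - b) * radialBessel n k r ^ 2) (Ioi 0) := by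
  refine ⟨(measurable_besselMoment_integrand hn b k).aestronglyMeasurable, ?_⟩
  rw [hasFiniteIntegral_iff_ofReal]
  · exact h.lt_top
  · filter_upwards [ae_restrict_mem measurableSet_Ioi] with r hr
    have := mem_Ioi.1 hr
    simp only [Pi.zero_apply]
    positivity

theorem exists_radialBessel_zero_gt {n : ℕ} (hn : 2 ≤ n) :
    ∃ δ > 0, ∀ r ∈ Ioo (0 : ℝ) δ, 1 / 2 < radialBessel n 0 r ^ 2 := by
  have hc := ((continuous_radialBessel hn 0).pow 2).continuousAt (x := (0 : ℝ))
  have hev : ∀ᶠ x in 𝓝[>] (0 : ℝ), 1 / 2 < radialBessel n 0 x ^ 2 := by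
    refine (hc.eventually (lt_mem_nhds ?_)).filter_mono nhdsWithin_le_nhds
    simp only [Pi.pow_apply, radialBessel_zero_zero]; norm_num
  obtain ⟨δ, hδ, h⟩ := mem_nhdsGT_iff_exists_Ioo_subset.1 hev
  exact ⟨δ, hδ, fun r hr => h hr⟩

/-- Since `B_0² > 1/2` near `0`, a finite moment makes `r^{n-1-b}` integrable there. -/
theorem lt_of_besselMoment_zero_ne_top {n : ℕ} (hn : 2 ≤ n) {b : ℝ}
    (h : besselMoment n b 0 ≠ ⊤) : b < n := by
  have hi := integrableOn_of_besselMoment_ne_top hn h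
  obtain ⟨δ, hδ, hB⟩ := exists_radialBessel_zero_gt hn
  have h1 : IntegrableOn (fun r : ℝ => r ^ ((n : ℝ) - 1 - b)) (Ioo 0 δ) := by
    refine ((hi.mono_set Ioo_subset_Ioi_self).const_mul 2).mono'
      (measurable_id.pow_const _).aestronglyMeasurable ?_
    filter_upwards [ae_restrict_mem measurableSet_Ioo] with r hr
    have hr0 : 0 < r := hr.1
    rw [Real.norm_of_nonneg (by positivity)]
    have := hB r hr
    have hp : 0 ≤ r ^ ((n : ℝ) - 1 - b) := by positivity
    nlinarith
  have := (intervalIntegral.integrableOn_Ioo_rpow_iff hδ).1 h1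
  linarith

/-- A single profile oscillates and may vanish, so both moments are needed: their sum has integrand
`r^{-b}` times the energy, which is bounded below by a positive constant for `r ≥ n - 1`. -/
theorem lt_of_besselMoment_ne_top {n : ℕ} (hn : 2 ≤ n) {b : ℝ}
    (h0 : besselMoment n b 0 ≠ ⊤) (h1 : besselMoment n b 1 ≠ ⊤) : 1 < b := by
  have hn' : (2 : ℝ) ≤ n := by exact_mod_cast hn
  have hi := (integrableOn_of_besselMoment_ne_top hn h0).add
    (integrableOn_of_besselMoment_ne_top hn h1)
  have hκ : (0 : ℝ) < n - 1 := by linarith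
  set ε : ℝ := besselEnergy n 0 (n - 1) / 3 * Real.exp (-1)
  have hε : 0 < ε := by
    have := besselEnergy_zero_pos hn hκ
    positivity
  have h2 : IntegrableOn (fun r : ℝ => r ^ (-b)) (Ioi ((n : ℝ) - 1)) := by
    refine ((hi.mono_set (Ioi_subset_Ioi hκ.le)).const_mul ε⁻¹).mono'
      (measurable_id.pow_const _).aestronglyMeasurable ?_
    filter_upwards [ae_restrict_mem measurableSet_Ioi] with r hr
    have hr0 : 0 < r := hκ.trans (mem_Ioi.1 hr)
    rw [Real.norm_of_nonneg (by positivity)]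
    have h := (besselEnergy_bounds hn 0 (r := r) (by push_cast; linarith [mem_Ioi.1 hr])).2
    simp only [Nat.cast_zero, mul_zero, zero_add] at h
    have e : r ^ ((n : ℝ) - 1 - b) * radialBessel n 0 r ^ 2 +
        r ^ ((n : ℝ) - 1 - b) * radialBessel n 1 r ^ 2 = r ^ (-b) * besselEnergy n 0 r := by
      rw [besselEnergy, sub_eq_add_neg ((n : ℝ) - 1), Real.rpow_add hr0]; ring
    simp only [Pi.add_apply]
    rw [e, inv_mul_eq_div, le_div_iff₀ hε]
    gcongr
  have := (integrableOn_Ioi_rpow_iff hκ).1 h2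
  linarith

theorem besselMoment_integral_zero_pos {n : ℕ} (hn : 2 ≤ n) {b : ℝ} (hb1 : 1 < b) (hbn : b < n) :
    0 < ∫ r in Ioi (0 : ℝ), r ^ ((n : ℝ) - 1 - b) * radialBessel n 0 r ^ 2 := by
  obtain ⟨δ, hδ, hB⟩ := exists_radialBessel_zero_gt hn
  have hnn : ∀ r ∈ Ioi (0 : ℝ), 0 ≤ r ^ ((n : ℝ) - 1 - b) * radialBessel n 0 r ^ 2 := fun r hr => by
    have := mem_Ioi.1 hr
    positivity
  rw [setIntegral_pos_iff_support_of_nonneg_ae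
    ((ae_restrict_mem measurableSet_Ioi).mono hnn) (integrableOn_besselMoment hn hb1 hbn 0)]
  have hsub : Ioo 0 δ ⊆ (Function.support fun r : ℝ => r ^ ((n : ℝ) - 1 - b) *
      radialBessel n 0 r ^ 2) ∩ Ioi 0 := fun r hr => by
    refine ⟨?_, hr.1⟩
    have hr0 : 0 < r := hr.1
    have : 0 < radialBessel n 0 r ^ 2 := by linarith [hB r hr]
    exact (by positivity : 0 < r ^ ((n : ℝ) - 1 - b) * radialBessel n 0 r ^ 2).ne'
  refine lt_of_lt_of_le ?_ (measure_mono hsub)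
  simpa using hδ

/-! ### Comparison of the moments with powers of `1 + λ_k`. -/

theorem exists_bounds_of_tendsto_pos {X : ℕ → ℝ} {L : ℝ} (hX : ∀ k, 0 < X k) (hL : 0 < L)
    (h : Tendsto X atTop (𝓝 L)) : ∃ c C : ℝ, 0 < c ∧ 0 < C ∧ ∀ k, c ≤ X k ∧ X k ≤ C := by
  obtain ⟨C, hC⟩ := h.bddAbove_range
  obtain ⟨D, hD⟩ := (h.inv₀ hL.ne').bddAbove_range
  have hC' : ∀ k, X k ≤ C := fun k => hC (mem_range_self k)
  have hD' : ∀ k, (X k)⁻¹ ≤ D := fun k => hD (mem_range_self k)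
  have hD0 : 0 < D := (inv_pos.2 (hX 0)).trans_le (hD' 0)
  exact ⟨D⁻¹, C, inv_pos.2 hD0, (hX 0).trans_le (hC' 0),
    fun k => ⟨inv_le_of_inv_le₀ (hX k) (hD' k), hC' k⟩⟩

/-- The eigenvalue `k (k + n - 2)` of `-Δ_ω` on the spherical harmonics of degree `k`. -/
def eigval (n k : ℕ) : ℝ := k * (k + n - 2)

theorem eigval_nonneg {n : ℕ} (hn : 2 ≤ n) (k : ℕ) : 0 ≤ eigval n k := by
  have hn' : (2 : ℝ) ≤ n := by exact_mod_cast hn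
  have hk : (0 : ℝ) ≤ k := k.cast_nonneg
  exact mul_nonneg hk (by linarith)

theorem eigval_injective {n : ℕ} (hn : 2 ≤ n) : Function.Injective (eigval n) := by
  have hn' : (2 : ℝ) ≤ n := by exact_mod_cast hn
  refine (strictMono_nat_of_lt_succ fun k => ?_).injective
  have hk : (0 : ℝ) ≤ k := k.cast_nonneg
  simp only [eigval]
  push_cast
  nlinarith

theorem tendsto_eigval_ratio (n : ℕ) :
    Tendsto (fun k : ℕ => (1 + eigval n (k + 1)) / (k : ℝ) ^ 2) atTop (𝓝 1) := by
  have h : Tendsto (fun k : ℕ => ((k : ℝ))⁻¹) atTop (𝓝 0) := tendsto_inv_atTop_nhds_zero_nat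
  have h2 : Tendsto (fun k : ℕ => ((k : ℝ))⁻¹ ^ 2 + (1 + (k : ℝ)⁻¹) *
      (1 + ((n : ℝ) - 1) * (k : ℝ)⁻¹)) atTop (𝓝 (0 ^ 2 + (1 + 0) * (1 + ((n : ℝ) - 1) * 0))) :=
    (h.pow 2).add ((tendsto_const_nhds.add h).mul
      (tendsto_const_nhds.add (tendsto_const_nhds.mul h)))
  simp only [ne_eq, OfNat.ofNat_ne_zero, not_false_eq_true, zero_pow, add_zero, mul_zero, mul_one,
    zero_add] at h2
  refine h2.congr' ?_
  filter_upwards [eventually_gt_atTop 0] with k hk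
  have : (k : ℝ) ≠ 0 := by positivity
  simp only [eigval]
  push_cast
  field_simp
  ring

theorem prod_range_eq_GammaSeq {s : ℝ} (hs : 0 < s) {k : ℕ} (hk : 0 < k) :
    ∏ j ∈ Finset.range (k + 1), (s + j) = (k : ℝ) ^ s * k.factorial / Real.GammaSeq s k := by
  have h1 : 0 < ∏ j ∈ Finset.range (k + 1), (s + j) := Finset.prod_pos fun j _ => by positivity
  have h2 : (0 : ℝ) < (k : ℝ) ^ s * k.factorial := by positivity
  rw [Real.GammaSeq, div_div_cancel₀ h2.ne']

/-- With `α = (n-b)/2` and `p = b - 1` the recurrence reads `A_{k+1} = A_k (α+k)/(α+p+k)`. Hence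
`A_k (1 + λ_k)^{p/2}` converges to `A_0 Γ(α+p)/Γ(α) > 0`, and a positive convergent sequence with
positive limit lies between positive constants. -/
theorem exists_besselMoment_bounds {n : ℕ} (hn : 2 ≤ n) {b : ℝ} (hb1 : 1 < b) (hbn : b < n) :
    ∃ c C : ℝ, 0 < c ∧ 0 < C ∧ ∀ k, ENNReal.ofReal c ≤
        ENNReal.ofReal ((1 + eigval n k) ^ ((b - 1) / 2)) * besselMoment n b k ∧
      ENNReal.ofReal ((1 + eigval n k) ^ ((b - 1) / 2)) * besselMoment n b k ≤
        ENNReal.ofReal C := by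
  have hn' : (2 : ℝ) ≤ n := by exact_mod_cast hn
  set A : ℕ → ℝ := fun k =>
    ∫ r in Ioi (0 : ℝ), r ^ ((n : ℝ) - 1 - b) * radialBessel n k r ^ 2 with hA
  set α : ℝ := (n - b) / 2 with hα
  set p : ℝ := b - 1 with hp
  have hα0 : 0 < α := by rw [hα]; linarith
  have hp0 : 0 < p := by rw [hp]; linarith
  have hrec : ∀ k : ℕ, A (k + 1) = A k * ((α + k) / (α + p + k)) := fun k => by
    have h := besselMoment_recurrence hn hb1 hbn k
    have hk : (0 : ℝ) ≤ k := k.cast_nonneg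
    have h2 : α + p + k ≠ 0 := by positivity
    rw [← mul_div_assoc, eq_div_iff h2]
    simp only [hA, hα, hp]
    linear_combination h / 2
  have hprod : ∀ k : ℕ, A k = A 0 * ((∏ j ∈ Finset.range k, (α + j)) /
      ∏ j ∈ Finset.range k, (α + p + j)) := fun k => by
    induction k with
    | zero => simp
    | succ k ih => rw [hrec, ih, Finset.prod_range_succ, Finset.prod_range_succ]; field_simp
  have hA0 : 0 < A 0 := besselMoment_integral_zero_pos hn hb1 hbn
  have hApos : ∀ k, 0 < A k := fun k => by
    rw [hprod]
    refine mul_pos hA0 (div_pos ?_ ?_) <;> exact Finset.prod_pos fun j _ => by positivity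
  -- The index is shifted because `Real.GammaSeq s k` has `k + 1` factors in its denominator:
  -- `A_{k+1}` is `A_0 k^{-p}` times the quotient of the `GammaSeq` values at `α + p` and `α`.
  have hlim : Tendsto (fun k : ℕ => A (k + 1) * (1 + eigval n (k + 1)) ^ (p / 2)) atTop
      (𝓝 (A 0 * (Real.Gamma (α + p) / Real.Gamma α) * 1 ^ (p / 2))) := by
    refine ((tendsto_const_nhds.mul ((Real.GammaSeq_tendsto_Gamma (α + p)).div
      (Real.GammaSeq_tendsto_Gamma α) (Real.Gamma_pos_of_pos hα0).ne')).mul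
      ((tendsto_eigval_ratio n).rpow_const (p := p / 2) (Or.inl one_ne_zero))).congr' ?_
    filter_upwards [eventually_gt_atTop 0] with k hk
    have hk0 : (0 : ℝ) < k := by positivity
    have hev : 0 ≤ 1 + eigval n (k + 1) := by linarith [eigval_nonneg hn (k + 1)]
    rw [hprod (k + 1), prod_range_eq_GammaSeq hα0 hk, prod_range_eq_GammaSeq (by positivity) hk,
      Real.div_rpow hev (by positivity), ← Real.rpow_natCast (k : ℝ) 2, ← Real.rpow_mul hk0.le,
      Real.rpow_add hk0]
    have e1 : ((2 : ℕ) : ℝ) * (p / 2) = p := by push_cast; ring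
    rw [e1]
    have : (0 : ℝ) < (k : ℝ) ^ p := by positivity
    have : (0 : ℝ) < (k : ℝ) ^ α := by positivity
    have : (k.factorial : ℝ) ≠ 0 := by positivity
    have g1 : Real.GammaSeq α k ≠ 0 := by
      have : 0 < ∏ j ∈ Finset.range (k + 1), (α + j) := Finset.prod_pos fun j _ => by positivity
      rw [Real.GammaSeq]; positivity
    simp only [Pi.div_apply]
    field_simp
  have hL : 0 < A 0 * (Real.Gamma (α + p) / Real.Gamma α) * 1 ^ (p / 2) := by
    have := Real.Gamma_pos_of_pos hα0
    have := Real.Gamma_pos_of_pos (add_pos hα0 hp0)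
    positivity
  have hpos : ∀ k, 0 < A k * (1 + eigval n k) ^ (p / 2) := fun k => by
    have := hApos k
    have := eigval_nonneg hn k
    positivity
  obtain ⟨c, C, hc, hC, h⟩ := exists_bounds_of_tendsto_pos hpos hL
    ((tendsto_add_atTop_iff_nat (f := fun k => A k * (1 + eigval n k) ^ (p / 2)) 1).1 hlim)
  refine ⟨c, C, hc, hC, fun k => ?_⟩
  have h0 : 0 ≤ (1 + eigval n k) ^ (p / 2) := by
    have := eigval_nonneg hn k
    positivity
  rw [besselMoment_eq_ofReal hn hb1 hbn, ← ENNReal.ofReal_mul h0, mul_comm]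
  exact ⟨ENNReal.ofReal_le_ofReal (h k).1, ENNReal.ofReal_le_ofReal (h k).2⟩

/-! ### Solid harmonics as polynomials. -/

open MvPolynomial in
/-- The Laplacian on polynomials. -/
def polyLap {n : ℕ} (p : MvPolynomial (Fin n) ℝ) : MvPolynomial (Fin n) ℝ :=
  ∑ i, pderiv i (pderiv i p)

open MvPolynomial in
/-- The polynomial `|x|²`. -/
def polyNormSq (n : ℕ) : MvPolynomial (Fin n) ℝ := ∑ i, X i ^ 2

open MvPolynomial in
/-- The rotation field `x_i ∂_j - x_j ∂_i` on polynomials. -/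
def polyRot {n : ℕ} (i j : Fin n) (p : MvPolynomial (Fin n) ℝ) : MvPolynomial (Fin n) ℝ :=
  X i * pderiv j p - X j * pderiv i p

/-- Solid spherical harmonics: the harmonic homogeneous polynomials of degree `k`. -/
structure IsSolidHarmonic {n : ℕ} (k : ℕ) (p : MvPolynomial (Fin n) ℝ) : Prop where
  homogeneous : p.IsHomogeneous k
  harmonic : polyLap p = 0

open MvPolynomial

theorem pderiv_pderiv_comm {n : ℕ} (i j : Fin n) (p : MvPolynomial (Fin n) ℝ) :
    pderiv i (pderiv j p) = pderiv j (pderiv i p) := by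
  induction p using MvPolynomial.induction_on with
  | C a => simp
  | add p q hp hq => simp [hp, hq]
  | mul_X p k hp =>
    simp only [Derivation.leibniz, pderiv_X, map_add, smul_eq_mul, hp]
    have h : ∀ a b : Fin n, pderiv a (Pi.single (M := fun _ => MvPolynomial (Fin n) ℝ) b 1 k) = 0 := by
      intro a b
      by_cases h : k = b
      · subst h; simp
      · simp [Pi.single_eq_of_ne h]
    rw [h, h]
    ring

theorem polyLap_pderiv {n : ℕ} (i : Fin n) (p : MvPolynomial (Fin n) ℝ) :
    polyLap (pderiv i p) = pderiv i (polyLap p) := by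
  simp only [polyLap, map_sum]
  refine Finset.sum_congr rfl fun j _ => ?_
  rw [pderiv_pderiv_comm j i, pderiv_pderiv_comm j i]

theorem polyLap_sub {n : ℕ} (p q : MvPolynomial (Fin n) ℝ) :
    polyLap (p - q) = polyLap p - polyLap q := by
  simp [polyLap, Finset.sum_sub_distrib]

theorem polyLap_C_mul {n : ℕ} (a : ℝ) (p : MvPolynomial (Fin n) ℝ) :
    polyLap (C a * p) = C a * polyLap p := by
  simp [polyLap, Finset.mul_sum, Derivation.leibniz]

theorem polyLap_mul {n : ℕ} (p q : MvPolynomial (Fin n) ℝ) :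
    polyLap (p * q) = p * polyLap q + 2 * ∑ i, pderiv i p * pderiv i q + q * polyLap p := by
  simp only [polyLap, Finset.mul_sum, ← Finset.sum_add_distrib, Derivation.leibniz, map_add,
    smul_eq_mul]
  exact Finset.sum_congr rfl fun i _ => by ring

theorem polyLap_X {n : ℕ} (i : Fin n) : polyLap (X i : MvPolynomial (Fin n) ℝ) = 0 := by
  refine Finset.sum_eq_zero fun j _ => ?_
  rw [pderiv_X]
  by_cases h : i = j
  · subst h; simp
  · simp [Pi.single_eq_of_ne h]

theorem pderiv_polyNormSq {n : ℕ} (i : Fin n) : pderiv i (polyNormSq n) = 2 * X i := by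
  simp only [polyNormSq, map_sum, Derivation.leibniz_pow, pderiv_X]
  rw [Finset.sum_eq_single i]
  · simp
  · intro j _ hj; simp [Pi.single_eq_of_ne hj]
  · simp

theorem polyLap_polyNormSq (n : ℕ) : polyLap (polyNormSq n) = 2 * (n : MvPolynomial (Fin n) ℝ) := by
  have h : ∀ i : Fin n, pderiv i (2 * X i : MvPolynomial (Fin n) ℝ) = 2 := fun i => by
    rw [two_mul, map_add, pderiv_X_self]; norm_num
  simp only [polyLap, pderiv_polyNormSq, h]
  simp [mul_comm]

namespace IsSolidHarmonic

variable {n k : ℕ} {p : MvPolynomial (Fin n) ℝ}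

theorem sum_X_mul_pderiv (h : IsSolidHarmonic k p) : ∑ i, X i * pderiv i p = C (k : ℝ) * p := by
  rw [h.homogeneous.sum_X_mul_pderiv, nsmul_eq_mul, map_natCast]

theorem pderiv_eq_zero (h : IsSolidHarmonic 0 p) (i : Fin n) : pderiv i p = 0 := by
  have e : p = C (coeff 0 p) := totalDegree_eq_zero_iff_eq_C.1
    (Nat.le_zero.1 h.homogeneous.totalDegree_le)
  rw [e, pderiv_C]

/-- The truncated degree `k - 1` is harmless at `k = 0`, where the derivative is zero. -/
protected theorem pderiv (h : IsSolidHarmonic k p) (i : Fin n) :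
    IsSolidHarmonic (k - 1) (pderiv i p) :=
  ⟨h.homogeneous.pderiv, by rw [polyLap_pderiv, h.harmonic, map_zero]⟩

theorem sum_X_mul_pderiv_pderiv (h : IsSolidHarmonic k p) (i : Fin n) :
    ∑ j, X j * pderiv j (pderiv i p) = C ((k : ℝ) - 1) * pderiv i p := by
  rcases k with _ | k
  · simp [h.pderiv_eq_zero i]
  · rw [(h.pderiv i).sum_X_mul_pderiv]; simp

/-- The component of `x_i p` in degree `k + 1`. -/
theorem raise (hn : 2 ≤ n) (h : IsSolidHarmonic k p) (i : Fin n) :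
    IsSolidHarmonic (k + 1)
      (X i * p - C ((2 * (k : ℝ) + n - 2)⁻¹) * (polyNormSq n * pderiv i p)) := by
  have hn' : (2 : ℝ) ≤ n := by exact_mod_cast hn
  constructor
  · refine ((add_comm 1 k) ▸ (isHomogeneous_X ℝ i).mul h.homogeneous).sub ?_
    rcases k with _ | k
    · rw [h.pderiv_eq_zero]; simp [isHomogeneous_zero]
    · have h1 : (polyNormSq n).IsHomogeneous 2 := by
        refine IsHomogeneous.sum _ _ _ fun j _ => ?_
        simpa using (isHomogeneous_X ℝ j).pow 2
      have h2 := (isHomogeneous_C (Fin n) ((2 * ((k + 1 : ℕ) : ℝ) + n - 2)⁻¹)).mul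
        (h1.mul (h.pderiv i).homogeneous)
      rwa [show 0 + (2 + (k + 1 - 1)) = k + 1 + 1 by omega] at h2
  -- By Euler's identity, `Δ(x_i p) = 2 ∂_i p` and `Δ(|x|² ∂_i p) = (2n + 4(k-1)) ∂_i p = 2(2k+n-2)
  -- ∂_i p`, which explains the coefficient.
  · have h1 : ∑ j, pderiv j (X i : MvPolynomial (Fin n) ℝ) * pderiv j p = pderiv i p := by
      rw [Finset.sum_eq_single i]
      · simp
      · intro j _ hj; rw [pderiv_X, Pi.single_eq_of_ne (Ne.symm hj)]; simp
      · simp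
    have h2 : ∑ j, pderiv j (polyNormSq n) * pderiv j (pderiv i p) =
        2 * (C ((k : ℝ) - 1) * pderiv i p) := by
      rw [← h.sum_X_mul_pderiv_pderiv i, Finset.mul_sum]
      exact Finset.sum_congr rfl fun j _ => by rw [pderiv_polyNormSq]; ring
    rw [polyLap_sub, polyLap_C_mul, polyLap_mul, polyLap_mul, h1, h2, h.harmonic,
      (h.pderiv i).harmonic, polyLap_X, polyLap_polyNormSq]
    -- For `k = 0` and `n = 2` the coefficient is `0⁻¹`, but then `∂_i p = 0`.
    rcases k with _ | k
    · rw [h.pderiv_eq_zero]; simp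
    · have h3 : (2 * ((k + 1 : ℕ) : ℝ) + n - 2) ≠ 0 := by
        have : (0 : ℝ) ≤ k := k.cast_nonneg
        push_cast
        exact ne_of_gt (by linarith)
      have h4 : C (2 * ((k + 1 : ℕ) : ℝ) + n - 2)⁻¹ * C (2 * ((k + 1 : ℕ) : ℝ) + n - 2)
          = (1 : MvPolynomial (Fin n) ℝ) := by
        rw [← C_mul, inv_mul_cancel₀ h3, C_1]
      simp only [map_add, map_sub, map_mul, map_natCast, map_ofNat, map_one] at h4 ⊢
      linear_combination (-2 * pderiv i p) * h4

/-- The summand is symmetric in `i, j` and zero on the diagonal, so the sum over all pairs is twice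
the wanted one. In that full sum the second-order terms reduce by `Δp = 0` and by Euler's identity
for `p` and `∂_i p`. -/
theorem polyRot_polyRot_sum (h : IsSolidHarmonic k p) :
    (∑ i : Fin n, ∑ j : Fin n, if i < j then polyRot i j (polyRot i j p) else 0) =
      -(C (eigval n k) * p) := by
  set S : Fin n → Fin n → MvPolynomial (Fin n) ℝ := fun i j => polyRot i j (polyRot i j p)
  have hsymm : ∀ i j, S i j = S j i := fun i j => by
    simp only [S, polyRot, map_sub, Derivation.leibniz, smul_eq_mul]; ring
  have hdiag : ∀ i, S i i = 0 := fun i => by simp [S, polyRot]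
  have hhalf : ∑ i, ∑ j, S i j = 2 * ∑ i, ∑ j, if i < j then S i j else 0 := by
    have h1 : ∑ i, ∑ j, (if j < i then S i j else 0) = ∑ i, ∑ j, if i < j then S i j else 0 := by
      rw [Finset.sum_comm]
      refine Finset.sum_congr rfl fun i _ => Finset.sum_congr rfl fun j _ => ?_
      rw [hsymm]
    rw [two_mul]
    nth_rewrite 2 [← h1]
    rw [← Finset.sum_add_distrib]
    refine Finset.sum_congr rfl fun i _ => ?_
    rw [← Finset.sum_add_distrib]
    refine Finset.sum_congr rfl fun j _ => ?_
    rcases lt_trichotomy i j with hij | hij | hij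
    · simp [hij, hij.not_gt]
    · subst hij; simp [hdiag]
    · simp [hij, hij.not_gt]
  have hS : ∀ i j, S i j =
      (X i ^ 2 * pderiv j (pderiv j p) - X i * pderiv i p - X i * (X j * pderiv j (pderiv i p))) +
      (X j ^ 2 * pderiv i (pderiv i p) - X j * pderiv j p - X j * (X i * pderiv i (pderiv j p))) +
      (if i = j then 2 * (X i * pderiv i p) else 0) := fun i j => by
    simp only [S, polyRot, map_sub, Derivation.leibniz, smul_eq_mul, pderiv_X]
    by_cases hij : i = j
    · subst hij; simp; ring
    · simp only [Pi.single_eq_of_ne hij, Pi.single_eq_of_ne (Ne.symm hij), Pi.single_eq_same,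
        if_neg hij]
      ring
  have hA : ∑ i : Fin n, ∑ j : Fin n, (X i ^ 2 * pderiv j (pderiv j p) - X i * pderiv i p -
      X i * (X j * pderiv j (pderiv i p))) = -(C ((k : ℝ) * (n + k - 1)) * p) := by
    have h0 : ∑ j, pderiv j (pderiv j p) = 0 := h.harmonic
    have h1 := h.sum_X_mul_pderiv
    have e1 : ∑ i : Fin n, ∑ j : Fin n, X i ^ 2 * pderiv j (pderiv j p) = 0 :=
      Finset.sum_eq_zero fun i _ => by rw [← Finset.mul_sum, h0, mul_zero]
    have e2 : ∑ i : Fin n, ∑ _j : Fin n, X i * pderiv i p = (n : MvPolynomial (Fin n) ℝ) *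
        (C (k : ℝ) * p) := by
      rw [← h1, Finset.mul_sum]
      exact Finset.sum_congr rfl fun i _ => by simp
    have e3 : ∑ i : Fin n, ∑ j : Fin n, X i * (X j * pderiv j (pderiv i p)) =
        C ((k : ℝ) - 1) * (C (k : ℝ) * p) := by
      rw [← h1, Finset.mul_sum]
      refine Finset.sum_congr rfl fun i _ => ?_
      rw [← Finset.mul_sum, h.sum_X_mul_pderiv_pderiv]; ring
    simp only [Finset.sum_sub_distrib, e1, e2, e3]
    simp only [map_mul, map_add, map_sub, map_natCast, map_one]
    ring
  have hB : ∑ i : Fin n, ∑ j : Fin n, (X j ^ 2 * pderiv i (pderiv i p) - X j * pderiv j p -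
      X j * (X i * pderiv i (pderiv j p))) = -(C ((k : ℝ) * (n + k - 1)) * p) := by
    rw [← hA, Finset.sum_comm]
  have hD : ∑ i : Fin n, ∑ j : Fin n, (if i = j then 2 * (X i * pderiv i p) else 0) =
      2 * (C (k : ℝ) * p) := by
    simp only [Finset.sum_ite_eq, Finset.mem_univ, if_true, ← Finset.mul_sum, h.sum_X_mul_pderiv]
  have hfull : ∑ i, ∑ j, S i j = 2 * -(C (eigval n k) * p) := by
    simp only [hS, Finset.sum_add_distrib]
    rw [hA, hB, hD]
    simp only [eigval, map_mul, map_add, map_sub, map_natCast, map_one, map_ofNat]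
    ring
  have := hhalf.symm.trans hfull
  exact mul_left_cancel₀ two_ne_zero this

end IsSolidHarmonic

/-! ### Polynomials as functions on the space and on the sphere. -/

/-- The complex-valued function on `ℝⁿ` given by a real polynomial. -/
def polyFun {n : ℕ} (p : MvPolynomial (Fin n) ℝ) (x : EuclideanSpace ℝ (Fin n)) : ℂ :=
  ((eval (fun i => x i) p : ℝ) : ℂ)

theorem contDiff_polyFun {n : ℕ} (p : MvPolynomial (Fin n) ℝ) :
    ContDiff ℝ ((⊤ : ℕ∞) : WithTop ℕ∞) (polyFun p) := by
  suffices h : ContDiff ℝ ((⊤ : ℕ∞) : WithTop ℕ∞)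
      (fun x : EuclideanSpace ℝ (Fin n) => eval (fun i => x i) p) from
    Complex.ofRealCLM.contDiff.comp h
  induction p using MvPolynomial.induction_on with
  | C a => simpa using contDiff_const
  | add p q hp hq => simpa using hp.add hq
  | mul_X p i hp =>
    simp only [map_mul, eval_X]
    exact hp.mul (EuclideanSpace.proj (𝕜 := ℝ) i).contDiff

theorem fderiv_polyFun {n : ℕ} (p : MvPolynomial (Fin n) ℝ) (x : EuclideanSpace ℝ (Fin n))
    (j : Fin n) : fderiv ℝ (polyFun p) x (EuclideanSpace.single j 1) = polyFun (pderiv j p) x := by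
  have hd : ∀ q : MvPolynomial (Fin n) ℝ, DifferentiableAt ℝ (polyFun q) x := fun q =>
    ((contDiff_polyFun q).differentiable (by simp)).differentiableAt
  induction p using MvPolynomial.induction_on with
  | C a =>
    have : polyFun (C a : MvPolynomial (Fin n) ℝ) = fun _ => (a : ℂ) := by
      funext y; simp [polyFun]
    rw [this]
    simp [polyFun]
  | add p q hp hq =>
    have : polyFun (p + q) = polyFun p + polyFun q := by funext y; simp [polyFun]
    rw [this, fderiv_add (hd p) (hd q)]
    simp [hp, hq, polyFun]
  | mul_X p i hp =>
    have h1 : polyFun (p * X i) = polyFun p * polyFun (X i) := by funext y; simp [polyFun]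
    have h2 : HasFDerivAt (polyFun (X i : MvPolynomial (Fin n) ℝ))
        (Complex.ofRealCLM.comp (EuclideanSpace.proj (𝕜 := ℝ) i)) x := by
      have : polyFun (X i : MvPolynomial (Fin n) ℝ) =
          Complex.ofRealCLM.comp (EuclideanSpace.proj (𝕜 := ℝ) i) := by
        funext y; simp [polyFun]
      rw [this]
      exact ContinuousLinearMap.hasFDerivAt _
    rw [h1, fderiv_mul (hd p) (hd _), h2.fderiv]
    simp only [add_apply, smul_apply, hp]
    by_cases hij : i = j
    · subst hij; simp [polyFun, Derivation.leibniz]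
    · simp [polyFun, Derivation.leibniz, hij, pderiv_X]

theorem rot_polyFun {n : ℕ} (i j : Fin n) (p : MvPolynomial (Fin n) ℝ) :
    rot i j (polyFun p) = polyFun (polyRot i j p) := by
  funext x
  simp only [rot, fderiv_polyFun, polyRot]
  simp [polyFun]

theorem lapBeltrami_polyFun {n k : ℕ} {p : MvPolynomial (Fin n) ℝ} (h : IsSolidHarmonic k p)
    (x : EuclideanSpace ℝ (Fin n)) :
    lapBeltrami (polyFun p) x = -(eigval n k : ℂ) * polyFun p x := by
  have h1 : lapBeltrami (polyFun p) x =
      polyFun (∑ i : Fin n, ∑ j : Fin n, if i < j then polyRot i j (polyRot i j p) else 0) x := by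
    simp only [lapBeltrami, rot_polyFun]
    simp only [polyFun, map_sum, Complex.ofReal_sum]
    refine Finset.sum_congr rfl fun i _ => Finset.sum_congr rfl fun j _ => ?_
    split_ifs <;> simp
  rw [h1, h.polyRot_polyRot_sum]
  simp [polyFun]

theorem eval_polyNormSq {n : ℕ} (ω : Sph n) :
    eval (fun i => (ω : EuclideanSpace ℝ (Fin n)) i) (polyNormSq n) = 1 := by
  have h := EuclideanSpace.real_norm_sq_eq (ω : EuclideanSpace ℝ (Fin n))
  rw [norm_eq_of_mem_sphere] at h
  simp [polyNormSq, ← h]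

/-- On the sphere, every polynomial is a sum of spherical harmonics. -/
theorem exists_mem_span_harmonic {n : ℕ} (hn : 2 ≤ n) (p : MvPolynomial (Fin n) ℝ) :
    ∃ q ∈ Submodule.span ℝ {q : MvPolynomial (Fin n) ℝ | ∃ k, IsSolidHarmonic k q},
      ∀ ω : Sph n, eval (fun i => (ω : EuclideanSpace ℝ (Fin n)) i) p =
        eval (fun i => (ω : EuclideanSpace ℝ (Fin n)) i) q := by
  induction p using MvPolynomial.induction_on with
  | C a =>
    refine ⟨C a, Submodule.subset_span ⟨0, isHomogeneous_C _ _, ?_⟩, fun _ => rfl⟩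
    simp [polyLap]
  | add p q hp hq =>
    obtain ⟨p', hp', hp⟩ := hp
    obtain ⟨q', hq', hq⟩ := hq
    exact ⟨p' + q', add_mem hp' hq', fun ω => by simp [hp, hq]⟩
  | mul_X p i hp =>
    obtain ⟨p', hp', hp⟩ := hp
    simp only [map_mul, eval_X, hp]
    clear hp
    induction hp' using Submodule.span_induction with
    | mem Y hY =>
      obtain ⟨k, hY⟩ := hY
      -- With `|x|² = 1`, the identity of `IsSolidHarmonic.raise` exhibits `x_i Y` as a harmonic of
      -- degree `k + 1` plus a multiple of `∂_i Y`.
      refine ⟨_, add_mem (Submodule.subset_span ⟨k + 1, hY.raise hn i⟩)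
        (Submodule.smul_mem _ (2 * (k : ℝ) + n - 2)⁻¹
          (Submodule.subset_span ⟨k - 1, hY.pderiv i⟩)), fun ω => ?_⟩
      simp only [map_add, map_sub, map_mul, eval_X, eval_C, eval_polyNormSq, smul_eval]
      ring
    | zero => exact ⟨0, zero_mem _, fun ω => by simp⟩
    | add a b _ _ ha hb =>
      obtain ⟨a', ha', ha⟩ := ha
      obtain ⟨b', hb', hb⟩ := hb
      exact ⟨a' + b', add_mem ha' hb', fun ω => by simp [← ha, ← hb, add_mul]⟩
    | smul c a _ ha =>
      obtain ⟨a', ha', ha⟩ := ha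
      exact ⟨c • a', Submodule.smul_mem _ _ ha', fun ω => by simp [smul_eval, ← ha, mul_assoc]⟩

/-! ### Rotation invariance and symmetry of the Laplace-Beltrami operator. -/

open scoped Pointwise

/-- The restriction to the unit sphere of a linear isometry. -/
def sphMap {n : ℕ} (L : (EuclideanSpace ℝ (Fin n)) ≃ₗᵢ[ℝ] EuclideanSpace ℝ (Fin n)) (ω : Sph n) : Sph n :=
  ⟨L ω, by simp⟩

/-- The surface measure of a set is a multiple of the volume of the cone over it, and `L` maps cones
to cones and preserves volume. -/
theorem measurePreserving_sphMap {n : ℕ} (L : (EuclideanSpace ℝ (Fin n)) ≃ₗᵢ[ℝ] EuclideanSpace ℝ (Fin n)) :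
    MeasurePreserving (sphMap L) (surf n) (surf n) := by
  have hm : Measurable (sphMap L) :=
    (Continuous.subtype_mk (L.continuous.comp continuous_subtype_val) _).measurable
  refine ⟨hm, Measure.ext fun s hs => ?_⟩
  rw [Measure.map_apply hm hs, Measure.toSphere_apply' _ (hm hs), Measure.toSphere_apply' _ hs]
  congr 1
  refine Eq.trans ?_ (L.measurePreserving.measure_preimage_equiv (f := L.toMeasurableEquiv)
    (Ioo (0 : ℝ) 1 • (Subtype.val '' s)))
  congr 1
  ext x
  simp only [Set.mem_smul, Set.mem_image, Set.mem_preimage, LinearIsometryEquiv.coe_toMeasurableEquiv]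
  constructor
  · rintro ⟨t, ht, _, ⟨ω, hω, rfl⟩, rfl⟩
    exact ⟨t, ht, _, ⟨sphMap L ω, hω, rfl⟩, by simp [sphMap]⟩
  · rintro ⟨t, ht, _, ⟨ω, hω, rfl⟩, h⟩
    refine ⟨t, ht, _, ⟨sphMap L.symm ω, ?_, rfl⟩, ?_⟩
    · convert hω using 1
      ext1; simp [sphMap]
    · apply L.injective
      rw [← h]; simp [sphMap]

theorem integral_sphMap {n : ℕ} (L : (EuclideanSpace ℝ (Fin n)) ≃ₗᵢ[ℝ] EuclideanSpace ℝ (Fin n)) {f : (EuclideanSpace ℝ (Fin n)) → ℂ} (hf : Continuous f) :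
    ∫ ω : Sph n, f (L ω) ∂(surf n) = ∫ ω : Sph n, f ω ∂(surf n) := by
  have h := measurePreserving_sphMap L
  have hc : Continuous fun ω : Sph n => f ω := hf.comp continuous_subtype_val
  have := integral_map (μ := surf n) h.measurable.aemeasurable
    (f := fun ω : Sph n => f ω) hc.aestronglyMeasurable
  rw [h.map_eq] at this
  exact this.symm

/-- The projection onto the coordinate plane of `e_i`, `e_j`. -/
def planeProj {n : ℕ} (i j : Fin n) : (EuclideanSpace ℝ (Fin n)) →L[ℝ] EuclideanSpace ℝ (Fin n) :=
  (EuclideanSpace.proj i : (EuclideanSpace ℝ (Fin n)) →L[ℝ] ℝ).smulRight (EuclideanSpace.single i 1) +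
    (EuclideanSpace.proj j : (EuclideanSpace ℝ (Fin n)) →L[ℝ] ℝ).smulRight (EuclideanSpace.single j 1)

/-- The generator of the rotations of the coordinate plane of `e_i`, `e_j`. -/
def planeGen {n : ℕ} (i j : Fin n) : (EuclideanSpace ℝ (Fin n)) →L[ℝ] EuclideanSpace ℝ (Fin n) :=
  (EuclideanSpace.proj i : (EuclideanSpace ℝ (Fin n)) →L[ℝ] ℝ).smulRight (EuclideanSpace.single j 1) -
    (EuclideanSpace.proj j : (EuclideanSpace ℝ (Fin n)) →L[ℝ] ℝ).smulRight (EuclideanSpace.single i 1)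

theorem planeProj_apply {n : ℕ} (i j : Fin n) (x : EuclideanSpace ℝ (Fin n)) :
    planeProj i j x = x i • EuclideanSpace.single i 1 + x j • EuclideanSpace.single j 1 := rfl

theorem planeGen_apply {n : ℕ} (i j : Fin n) (x : EuclideanSpace ℝ (Fin n)) :
    planeGen i j x = x i • EuclideanSpace.single j 1 - x j • EuclideanSpace.single i 1 := rfl

/-- The rotation by the angle `t` in the coordinate plane of `e_i`, `e_j`. -/
def planeRot {n : ℕ} (i j : Fin n) (t : ℝ) (x : EuclideanSpace ℝ (Fin n)) : EuclideanSpace ℝ (Fin n) :=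
  x + (Real.cos t - 1) • planeProj i j x + Real.sin t • planeGen i j x

theorem norm_planeRot {n : ℕ} {i j : Fin n} (hij : i ≠ j) (t : ℝ) (x : EuclideanSpace ℝ (Fin n)) :
    ‖planeRot i j t x‖ = ‖x‖ := by
  have h : inner ℝ (planeRot i j t x) (planeRot i j t x) = inner ℝ x x := by
    simp only [planeRot, planeProj_apply, planeGen_apply, inner_add_left, inner_add_right,
      inner_sub_left, inner_sub_right, inner_smul_left, inner_smul_right,
      EuclideanSpace.inner_single_left, EuclideanSpace.inner_single_right]
    simp [hij, hij.symm]
    linear_combination ((x i) ^ 2 + (x j) ^ 2) * Real.sin_sq_add_cos_sq t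
  rw [real_inner_self_eq_norm_sq, real_inner_self_eq_norm_sq] at h
  exact (sq_eq_sq₀ (norm_nonneg _) (norm_nonneg _)).1 h

/-- `planeRot` as a linear isometry. -/
def planeRotIso {n : ℕ} {i j : Fin n} (hij : i ≠ j) (t : ℝ) : (EuclideanSpace ℝ (Fin n)) ≃ₗᵢ[ℝ] EuclideanSpace ℝ (Fin n) :=
  LinearIsometry.toLinearIsometryEquiv
    (li := ⟨(ContinuousLinearMap.id ℝ (EuclideanSpace ℝ (Fin n)) + (Real.cos t - 1) • planeProj i j +
      Real.sin t • planeGen i j : (EuclideanSpace ℝ (Fin n)) →L[ℝ] EuclideanSpace ℝ (Fin n)), norm_planeRot hij t⟩) rfl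

theorem hasDerivAt_planeRot {n : ℕ} (i j : Fin n) (t : ℝ) (x : EuclideanSpace ℝ (Fin n)) :
    HasDerivAt (fun t => planeRot i j t x)
      (-Real.sin t • planeProj i j x + Real.cos t • planeGen i j x) t := by
  have h1 := ((Real.hasDerivAt_cos t).sub_const 1).smul_const (planeProj i j x)
  have h2 := (Real.hasDerivAt_sin t).smul_const (planeGen i j x)
  exact (h1.const_add x).add h2

theorem rot_eq_fderiv_planeGen {n : ℕ} (i j : Fin n) (φ : (EuclideanSpace ℝ (Fin n)) → ℂ) (x : EuclideanSpace ℝ (Fin n)) :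
    rot i j φ x = fderiv ℝ φ x (planeGen i j x) := by
  rw [planeGen_apply, map_sub, map_smul, map_smul, rot]
  simp

theorem integrable_of_continuous {n : ℕ} {F : Type*} [NormedAddCommGroup F] {f : Sph n → F}
    (hf : Continuous f) : Integrable f (surf n) :=
  hf.integrable_of_hasCompactSupport (HasCompactSupport.of_compactSpace f)

/-- The integral of `φ` composed with the rotation by `t` does not depend on `t`; its derivative at
`t = 0` is the integral of `rot i j φ`. -/
theorem integral_rot_eq_zero {n : ℕ} {i j : Fin n} (hij : i ≠ j) {φ : (EuclideanSpace ℝ (Fin n)) → ℂ}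
    (hφ : ContDiff ℝ 1 φ) : ∫ ω : Sph n, rot i j φ ω ∂(surf n) = 0 := by
  have hdf : ∀ x, HasFDerivAt φ (fderiv ℝ φ x) x := fun x =>
    (hφ.differentiable one_ne_zero).differentiableAt.hasFDerivAt
  obtain ⟨M, hM⟩ := (isCompact_sphere (0 : EuclideanSpace ℝ (Fin n)) 1).exists_bound_of_continuousOn
    (hφ.continuous_fderiv one_ne_zero).continuousOn
  have hrc : ∀ t, Continuous fun x : EuclideanSpace ℝ (Fin n) => planeRot i j t x := fun t =>
    (planeRotIso hij t).continuous
  have key := hasDerivAt_integral_of_dominated_loc_of_deriv_le (μ := surf n) (𝕜 := ℝ)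
    (F := fun t (ω : Sph n) => φ (planeRot i j t ω))
    (F' := fun t (ω : Sph n) => fderiv ℝ φ (planeRot i j t ω)
      (-Real.sin t • planeProj i j (ω : EuclideanSpace ℝ (Fin n)) + Real.cos t • planeGen i j (ω : EuclideanSpace ℝ (Fin n))))
    (x₀ := 0) (s := univ) (bound := fun _ => M * (‖planeProj i j‖ + ‖planeGen (n := n) i j‖))
    univ_mem
    (Eventually.of_forall fun t =>
      (hφ.continuous.comp ((hrc t).comp continuous_subtype_val)).aestronglyMeasurable)
    (integrable_of_continuous (hφ.continuous.comp ((hrc 0).comp continuous_subtype_val)))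
    (by
      refine Continuous.aestronglyMeasurable ?_
      refine ((hφ.continuous_fderiv one_ne_zero).comp
        ((hrc 0).comp continuous_subtype_val)).clm_apply ?_
      fun_prop)
    (Eventually.of_forall fun ω t _ => by
      have h1 : ‖fderiv ℝ φ (planeRot i j t ω)‖ ≤ M := by
        refine hM _ ?_
        rw [mem_sphere_zero_iff_norm, norm_planeRot hij, norm_eq_of_mem_sphere]
      have h2 : ‖-Real.sin t • planeProj i j (ω : EuclideanSpace ℝ (Fin n)) + Real.cos t • planeGen i j (ω : EuclideanSpace ℝ (Fin n))‖ ≤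
          ‖planeProj i j‖ + ‖planeGen (n := n) i j‖ := by
        refine (norm_add_le _ _).trans (add_le_add ?_ ?_)
        · rw [norm_smul, norm_neg]
          have := (planeProj i j).le_opNorm (ω : EuclideanSpace ℝ (Fin n))
          rw [norm_eq_of_mem_sphere, mul_one] at this
          exact (mul_le_of_le_one_left (norm_nonneg _) (Real.abs_sin_le_one t)).trans this
        · rw [norm_smul]
          have := (planeGen i j).le_opNorm (ω : EuclideanSpace ℝ (Fin n))
          rw [norm_eq_of_mem_sphere, mul_one] at this
          exact (mul_le_of_le_one_left (norm_nonneg _) (Real.abs_cos_le_one t)).trans this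
      exact (ContinuousLinearMap.le_opNorm _ _).trans
        (mul_le_mul h1 h2 (norm_nonneg _) ((norm_nonneg _).trans h1)))
    (integrable_const _)
    (Eventually.of_forall fun ω t _ =>
      (hdf _).comp_hasDerivAt t (hasDerivAt_planeRot i j t (ω : EuclideanSpace ℝ (Fin n))))
  have hconst : (fun t => ∫ ω : Sph n, φ (planeRot i j t ω) ∂(surf n)) =
      fun _ => ∫ ω : Sph n, φ ω ∂(surf n) := by
    funext t
    exact integral_sphMap (planeRotIso hij t) hφ.continuous
  have h2 := key.2
  rw [hconst] at h2
  have h3 := h2.unique (hasDerivAt_const (0 : ℝ) _)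
  rw [← h3]
  refine integral_congr_ae (Eventually.of_forall fun ω => ?_)
  simp [rot_eq_fderiv_planeGen, planeRot]

theorem contDiff_rot {n : ℕ} (i j : Fin n) {φ : (EuclideanSpace ℝ (Fin n)) → ℂ}
    (hφ : ContDiff ℝ ((⊤ : ℕ∞) : WithTop ℕ∞) φ) :
    ContDiff ℝ ((⊤ : ℕ∞) : WithTop ℕ∞) (rot i j φ) := by
  have h : rot i j φ = fun x => fderiv ℝ φ x (planeGen i j x) :=
    funext fun x => rot_eq_fderiv_planeGen i j φ x
  rw [h]
  exact (hφ.fderiv_right (by simp)).clm_apply (planeGen i j).contDiff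

theorem contDiff_lapBeltrami {n : ℕ} {φ : (EuclideanSpace ℝ (Fin n)) → ℂ}
    (hφ : ContDiff ℝ ((⊤ : ℕ∞) : WithTop ℕ∞) φ) :
    ContDiff ℝ ((⊤ : ℕ∞) : WithTop ℕ∞) (lapBeltrami φ) := by
  unfold lapBeltrami
  refine ContDiff.sum fun i _ => ContDiff.sum fun j _ => ?_
  split_ifs
  · exact contDiff_rot i j (contDiff_rot i j hφ)
  · exact contDiff_const

theorem integral_rot_mul {n : ℕ} {i j : Fin n} (hij : i ≠ j) {φ ψ : (EuclideanSpace ℝ (Fin n)) → ℂ}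
    (hφ : ContDiff ℝ ((⊤ : ℕ∞) : WithTop ℕ∞) φ) (hψ : ContDiff ℝ ((⊤ : ℕ∞) : WithTop ℕ∞) ψ) :
    ∫ ω : Sph n, rot i j φ ω * ψ ω ∂(surf n) = -∫ ω : Sph n, φ ω * rot i j ψ ω ∂(surf n) := by
  have hle : (1 : WithTop ℕ∞) ≤ ((⊤ : ℕ∞) : WithTop ℕ∞) := by exact_mod_cast le_top
  have h := integral_rot_eq_zero hij ((hφ.mul hψ).of_le hle)
  have hd : ∀ {f : (EuclideanSpace ℝ (Fin n)) → ℂ}, ContDiff ℝ ((⊤ : ℕ∞) : WithTop ℕ∞) f → ∀ x,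
      DifferentiableAt ℝ f x := fun hf x => (hf.differentiable (by simp)).differentiableAt
  have hL : ∀ x, rot i j (fun x => φ x * ψ x) x = rot i j φ x * ψ x + φ x * rot i j ψ x :=
    fun x => by
      rw [rot_eq_fderiv_planeGen, rot_eq_fderiv_planeGen, rot_eq_fderiv_planeGen,
        fderiv_fun_mul (hd hφ x) (hd hψ x)]
      simp only [add_apply, smul_apply, smul_eq_mul]
      ring
  have hc : ∀ {f g : (EuclideanSpace ℝ (Fin n)) → ℂ}, ContDiff ℝ ((⊤ : ℕ∞) : WithTop ℕ∞) f →
      ContDiff ℝ ((⊤ : ℕ∞) : WithTop ℕ∞) g → Integrable (fun ω : Sph n => f ω * g ω) (surf n) :=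
    fun hf hg => integrable_of_continuous
      ((hf.continuous.mul hg.continuous).comp continuous_subtype_val)
  simp only [hL] at h
  rw [integral_add (hc (contDiff_rot i j hφ) hψ) (hc hφ (contDiff_rot i j hψ))] at h
  exact eq_neg_of_add_eq_zero_left h

theorem integral_lapBeltrami_mul {n : ℕ} {φ ψ : (EuclideanSpace ℝ (Fin n)) → ℂ}
    (hφ : ContDiff ℝ ((⊤ : ℕ∞) : WithTop ℕ∞) φ) (hψ : ContDiff ℝ ((⊤ : ℕ∞) : WithTop ℕ∞) ψ) :
    ∫ ω : Sph n, lapBeltrami φ ω * ψ ω ∂(surf n) =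
      ∫ ω : Sph n, φ ω * lapBeltrami ψ ω ∂(surf n) := by
  have hc : ∀ {f g : (EuclideanSpace ℝ (Fin n)) → ℂ}, ContDiff ℝ ((⊤ : ℕ∞) : WithTop ℕ∞) f →
      ContDiff ℝ ((⊤ : ℕ∞) : WithTop ℕ∞) g → Integrable (fun ω : Sph n => f ω * g ω) (surf n) :=
    fun hf hg => integrable_of_continuous
      ((hf.continuous.mul hg.continuous).comp continuous_subtype_val)
  have hi : ∀ {f g : (EuclideanSpace ℝ (Fin n)) → ℂ}, ContDiff ℝ ((⊤ : ℕ∞) : WithTop ℕ∞) f →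
      ContDiff ℝ ((⊤ : ℕ∞) : WithTop ℕ∞) g → ∀ i j : Fin n, Integrable
        (fun ω : Sph n => if i < j then rot i j (rot i j f) ω * g ω else 0) (surf n) := by
    intro f g hf hg i j
    split_ifs
    · exact hc (contDiff_rot i j (contDiff_rot i j hf)) hg
    · exact integrable_zero _ _ _
  have e1 : ∀ {f g : (EuclideanSpace ℝ (Fin n)) → ℂ}, ContDiff ℝ ((⊤ : ℕ∞) : WithTop ℕ∞) f →
      ContDiff ℝ ((⊤ : ℕ∞) : WithTop ℕ∞) g →
      ∫ ω : Sph n, lapBeltrami f ω * g ω ∂(surf n) = ∑ i : Fin n, ∑ j : Fin n,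
        ∫ ω : Sph n, (if i < j then rot i j (rot i j f) ω * g ω else 0) ∂(surf n) := by
    intro f g hf hg
    simp only [lapBeltrami, Finset.sum_mul, ite_mul, zero_mul]
    rw [integral_finsetSum _ fun i _ => integrable_finsetSum _ fun j _ => hi hf hg i j]
    exact Finset.sum_congr rfl fun i _ => integral_finsetSum _ fun j _ => hi hf hg i j
  have e2 : ∫ ω : Sph n, φ ω * lapBeltrami ψ ω ∂(surf n) =
      ∫ ω : Sph n, lapBeltrami ψ ω * φ ω ∂(surf n) := by simp only [mul_comm]
  rw [e2, e1 hφ hψ, e1 hψ hφ]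
  refine Finset.sum_congr rfl fun i _ => Finset.sum_congr rfl fun j _ => ?_
  by_cases hij : i < j
  · simp only [hij, if_true]
    rw [integral_rot_mul hij.ne (contDiff_rot i j hφ) hψ]
    have := integral_rot_mul hij.ne (contDiff_rot i j hψ) hφ
    rw [this]
    simp only [mul_comm]
  · simp [hij]

theorem integral_shifted_mul_polyFun {n k : ℕ} {p : MvPolynomial (Fin n) ℝ}
    (h : IsSolidHarmonic k p) {φ : (EuclideanSpace ℝ (Fin n)) → ℂ} (hφ : ContDiff ℝ ((⊤ : ℕ∞) : WithTop ℕ∞) φ)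
    (lam : ℝ) :
    ∫ ω : Sph n, (lapBeltrami φ ω + lam * φ ω) * polyFun p ω ∂(surf n) =
      (lam - eigval n k) * ∫ ω : Sph n, φ ω * polyFun p ω ∂(surf n) := by
  have h1 := integral_lapBeltrami_mul hφ (contDiff_polyFun p)
  simp only [lapBeltrami_polyFun h] at h1
  have hc : ∀ {f g : (EuclideanSpace ℝ (Fin n)) → ℂ}, Continuous f → Continuous g →
      Integrable (fun ω : Sph n => f ω * g ω) (surf n) :=
    fun hf hg => integrable_of_continuous ((hf.mul hg).comp continuous_subtype_val)
  have hp := (contDiff_polyFun p).continuous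
  simp only [add_mul, mul_assoc]
  rw [integral_add (hc (contDiff_lapBeltrami hφ).continuous hp)
    ((hc hφ.continuous hp).const_mul _), h1, integral_const_mul, sub_mul, sub_eq_neg_add,
    ← integral_const_mul, ← integral_const_mul, ← integral_neg]
  congr 1
  exact integral_congr_ae (Eventually.of_forall fun ω => by simp only; ring)

/-- Symmetry of the Laplacian against the constant `1`, whose eigenvalue is `0 ≠ λ_k`. -/
theorem integral_polyFun_eq_zero {n k : ℕ} (hn : 2 ≤ n) (hk : k ≠ 0)
    {p : MvPolynomial (Fin n) ℝ} (h : IsSolidHarmonic k p) :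
    ∫ ω : Sph n, polyFun p ω ∂(surf n) = 0 := by
  have h1 := integral_shifted_mul_polyFun h (φ := fun _ => 1) contDiff_const (eigval n 0)
  have h2 : ∀ x : EuclideanSpace ℝ (Fin n), lapBeltrami (fun _ => 1) x = 0 := fun x => by
    have : ∀ i j : Fin n, rot i j (fun _ : EuclideanSpace ℝ (Fin n) => (1 : ℂ)) = fun _ => 0 := fun i j => by
      funext y; simp [rot]
    have h0 : ∀ i j : Fin n, rot i j (fun _ : EuclideanSpace ℝ (Fin n) => (0 : ℂ)) = fun _ => 0 := fun i j => by
      funext y; simp [rot]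
    simp [lapBeltrami, this, h0]
  simp only [h2, one_mul, eigval, Nat.cast_zero, zero_mul, Complex.ofReal_zero, add_zero,
    integral_zero, zero_sub] at h1
  refine (mul_eq_zero.1 h1.symm).resolve_left ?_
  have := (eigval_injective hn).ne hk
  refine neg_ne_zero.2 (Complex.ofReal_ne_zero.2 ?_)
  simpa [eigval] using this

/-! ### The Funk-Hecke formula and the Fourier transform of a harmonic. -/

/-- The total mass of the surface measure. -/
def sphArea (n : ℕ) : ℝ := (surf n).real univ

theorem sphArea_pos {n : ℕ} (hn : 2 ≤ n) : 0 < sphArea n := by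
  have : Nonempty (Fin n) := ⟨⟨0, by omega⟩⟩
  have : surf n ≠ 0 := Measure.toSphere_ne_zero _
  rw [sphArea, measureReal_def]
  exact ENNReal.toReal_pos (Measure.measure_univ_ne_zero.2 this) (measure_ne_top _ _)

/-- The Funk-Hecke coefficient of `t^j` in degree `k`, relative to the area of the sphere. -/
def funkHecke (n j k : ℕ) : ℝ :=
  if k ≤ j ∧ Even (j - k) then
    j.factorial * recPoch n ((j + k) / 2) / (2 ^ j * ((j - k) / 2).factorial) else 0

theorem funkHecke_add_two_mul (n k m : ℕ) :
    funkHecke n (k + 2 * m) k =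
      (k + 2 * m).factorial * recPoch n (k + m) / (2 ^ (k + 2 * m) * m.factorial) := by
  rw [funkHecke, if_pos ⟨by omega, by simp⟩, show (k + 2 * m + k) / 2 = k + m by omega,
    show (k + 2 * m - k) / 2 = m by omega]

theorem funkHecke_eq_zero {n j k : ℕ} (h : ∀ m, j ≠ k + 2 * m) : funkHecke n j k = 0 := by
  rw [funkHecke, if_neg]
  rintro ⟨h1, m, h2⟩
  exact h m (by omega)

theorem funkHecke_succ_zero {n : ℕ} (hn : 2 ≤ n) (j : ℕ) :
    funkHecke n (j + 1) 0 = funkHecke n j 1 := by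
  have hn' : (2 : ℝ) ≤ n := by exact_mod_cast hn
  by_cases h : ∃ m, j = 1 + 2 * m
  · obtain ⟨m, rfl⟩ := h
    have h1 := funkHecke_add_two_mul n 0 (m + 1)
    rw [show 0 + 2 * (m + 1) = 1 + 2 * m + 1 by ring] at h1
    rw [h1, funkHecke_add_two_mul, Nat.factorial_succ (1 + 2 * m), Nat.factorial_succ m, pow_succ,
      show 0 + (m + 1) = 1 + m by ring]
    push_cast
    field_simp
    ring
  · push Not at h
    rw [funkHecke_eq_zero h, funkHecke_eq_zero]
    rintro (_ | m) hm
    · omega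
    · exact h m (by omega)

/-- Together with `funkHecke_succ_zero`, this is the recursion in `j` produced by splitting off one
factor `θ·ω` from `(θ·ω)^{j+1}`. -/
theorem funkHecke_succ_succ {n : ℕ} (hn : 2 ≤ n) (j k : ℕ) :
    funkHecke n (j + 1) (k + 1) * (2 * k + n) =
      funkHecke n j (k + 2) * (k + n - 1) + funkHecke n j k * (k + 1) := by
  have hn' : (2 : ℝ) ≤ n := by exact_mod_cast hn
  by_cases h : ∃ m, j = k + 2 * m
  · obtain ⟨m, rfl⟩ := h
    rw [show k + 2 * m + 1 = k + 1 + 2 * m by ring, funkHecke_add_two_mul, funkHecke_add_two_mul,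
      recPoch_succ hn (k + m), show k + 1 + 2 * m = (k + 2 * m) + 1 by ring,
      Nat.factorial_succ (k + 2 * m), pow_succ, show k + 1 + m = k + m + 1 by ring]
    rcases m with _ | m
    · rw [funkHecke_eq_zero (n := n) (k := k + 2) (fun m => by omega)]
      push_cast
      field_simp
      ring
    · have h1 := funkHecke_add_two_mul n (k + 2) m
      rw [show k + 2 + 2 * m = k + 2 * (m + 1) by ring, show k + 2 + m = k + (m + 1) + 1 by ring]
        at h1
      rw [h1, Nat.factorial_succ m]
      push_cast
      field_simp
      ring
  · push Not at h
    rw [funkHecke_eq_zero h, funkHecke_eq_zero (k := k + 2) fun m hm => h (m + 1) (by omega),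
      funkHecke_eq_zero fun m hm => h m (by omega)]
    simp

/-- The restriction of a real polynomial to the sphere. -/
def evalSph {n : ℕ} (p : MvPolynomial (Fin n) ℝ) (ω : Sph n) : ℝ :=
  eval (fun i => (ω : EuclideanSpace ℝ (Fin n)) i) p

theorem continuous_evalSph {n : ℕ} (p : MvPolynomial (Fin n) ℝ) : Continuous (evalSph p) := by
  refine (MvPolynomial.continuous_eval p).comp ?_
  exact (PiLp.continuous_ofLp 2 _).comp continuous_subtype_val

theorem polyFun_eq_evalSph {n : ℕ} (p : MvPolynomial (Fin n) ℝ) (ω : Sph n) :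
    polyFun p ω = (evalSph p ω : ℂ) := rfl

/-- Induction on `j` for all degrees at once: one factor `∑ θ_i ω_i` is absorbed into the harmonic,
each `ω_i Y` splits into degrees `k + 1` and `k - 1`, and the sum over `i` collapses at `θ`. -/
theorem integral_inner_pow_mul {n : ℕ} (hn : 2 ≤ n) (j : ℕ) : ∀ {k : ℕ}
    {p : MvPolynomial (Fin n) ℝ}, IsSolidHarmonic k p → ∀ θ : Sph n,
    ∫ ω : Sph n, (inner ℝ (θ : EuclideanSpace ℝ (Fin n)) (ω : EuclideanSpace ℝ (Fin n))) ^ j *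
      evalSph p ω ∂(surf n) = sphArea n * funkHecke n j k * evalSph p θ := by
  have hn' : (2 : ℝ) ≤ n := by exact_mod_cast hn
  induction j with
  | zero =>
    intro k p h θ
    simp only [pow_zero, one_mul]
    rcases k with _ | k
    · obtain ⟨a, rfl⟩ : ∃ a, p = C a := ⟨_, totalDegree_eq_zero_iff_eq_C.1
        (Nat.le_zero.1 h.homogeneous.totalDegree_le)⟩
      simp [evalSph, funkHecke, recPoch_zero, sphArea]
    · have h1 := integral_polyFun_eq_zero hn k.succ_ne_zero h
      simp only [polyFun_eq_evalSph] at h1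
      rw [integral_complex_ofReal, Complex.ofReal_eq_zero] at h1
      rw [h1, funkHecke_eq_zero fun m => by omega]
      simp
  | succ j ih =>
    intro k p h θ
    set c : ℝ := (2 * (k : ℝ) + n - 2)⁻¹ with hc
    have hdec : ∀ (i : Fin n) (ω : Sph n), (ω : EuclideanSpace ℝ (Fin n)) i * evalSph p ω =
        evalSph (X i * p - C c * (polyNormSq n * pderiv i p)) ω + c * evalSph (pderiv i p) ω := by
      intro i ω
      simp only [evalSph, map_sub, map_mul, eval_X, eval_C, eval_polyNormSq]
      ring
    have hin : Continuous fun ω : Sph n =>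
        inner ℝ (θ : EuclideanSpace ℝ (Fin n)) (ω : EuclideanSpace ℝ (Fin n)) := by fun_prop
    have hint : ∀ q : MvPolynomial (Fin n) ℝ, Integrable (fun ω : Sph n =>
        (inner ℝ (θ : EuclideanSpace ℝ (Fin n)) (ω : EuclideanSpace ℝ (Fin n))) ^ j * evalSph q ω)
        (surf n) := fun q => integrable_of_continuous ((hin.pow j).mul (continuous_evalSph q))
    have hpt : ∀ ω : Sph n,
        (inner ℝ (θ : EuclideanSpace ℝ (Fin n)) (ω : EuclideanSpace ℝ (Fin n))) ^ (j + 1) *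
          evalSph p ω = ∑ i, (θ : EuclideanSpace ℝ (Fin n)) i *
          ((inner ℝ (θ : EuclideanSpace ℝ (Fin n)) (ω : EuclideanSpace ℝ (Fin n))) ^ j *
            evalSph (X i * p - C c * (polyNormSq n * pderiv i p)) ω +
          c * ((inner ℝ (θ : EuclideanSpace ℝ (Fin n)) (ω : EuclideanSpace ℝ (Fin n))) ^ j *
            evalSph (pderiv i p) ω)) := by
      intro ω
      have h1 : inner ℝ (θ : EuclideanSpace ℝ (Fin n)) (ω : EuclideanSpace ℝ (Fin n)) =
          ∑ i, (θ : EuclideanSpace ℝ (Fin n)) i * (ω : EuclideanSpace ℝ (Fin n)) i := by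
        rw [PiLp.inner_apply]
        exact Finset.sum_congr rfl fun i _ => by simp [mul_comm]
      rw [pow_succ, mul_assoc]
      nth_rewrite 2 [h1]
      rw [Finset.sum_mul, Finset.mul_sum]
      refine Finset.sum_congr rfl fun i _ => ?_
      rw [mul_assoc, hdec]
      ring
    simp only [hpt]
    have hsum : ∀ i : Fin n, Integrable (fun ω : Sph n => (θ : EuclideanSpace ℝ (Fin n)) i *
          ((inner ℝ (θ : EuclideanSpace ℝ (Fin n)) (ω : EuclideanSpace ℝ (Fin n))) ^ j *
            evalSph (X i * p - C c * (polyNormSq n * pderiv i p)) ω +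
          c * ((inner ℝ (θ : EuclideanSpace ℝ (Fin n)) (ω : EuclideanSpace ℝ (Fin n))) ^ j *
            evalSph (pderiv i p) ω))) (surf n) :=
      fun i => ((hint _).add ((hint _).const_mul c)).const_mul _
    rw [integral_finsetSum _ fun i _ => hsum i]
    have hterm : ∀ i : Fin n, ∫ ω : Sph n, (θ : EuclideanSpace ℝ (Fin n)) i *
          ((inner ℝ (θ : EuclideanSpace ℝ (Fin n)) (ω : EuclideanSpace ℝ (Fin n))) ^ j *
            evalSph (X i * p - C c * (polyNormSq n * pderiv i p)) ω +
          c * ((inner ℝ (θ : EuclideanSpace ℝ (Fin n)) (ω : EuclideanSpace ℝ (Fin n))) ^ j *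
            evalSph (pderiv i p) ω)) ∂(surf n) =
        (sphArea n * funkHecke n j (k + 1) * evalSph p θ) * (θ : EuclideanSpace ℝ (Fin n)) i ^ 2 +
        (sphArea n * c * (funkHecke n j (k - 1) - funkHecke n j (k + 1))) *
          ((θ : EuclideanSpace ℝ (Fin n)) i * evalSph (pderiv i p) θ) := by
      intro i
      rw [integral_const_mul, integral_add (hint _) ((hint _).const_mul c), integral_const_mul,
        ih (h.raise hn i), ih (h.pderiv i), eq_sub_of_add_eq (hdec i θ).symm]
      ring
    -- The two sums over `i` that remain are `|θ|² = 1` and Euler's identity.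
    have e1 : ∑ i, (θ : EuclideanSpace ℝ (Fin n)) i ^ 2 = 1 := by
      simpa [polyNormSq] using eval_polyNormSq θ
    have e2 : ∑ i, (θ : EuclideanSpace ℝ (Fin n)) i * evalSph (pderiv i p) θ =
        k * evalSph p θ := by
      have := congrArg (eval fun i => (θ : EuclideanSpace ℝ (Fin n)) i) h.sum_X_mul_pderiv
      simpa [evalSph] using this
    simp only [hterm]
    rw [Finset.sum_add_distrib, ← Finset.mul_sum, ← Finset.mul_sum, e1, e2]
    rcases k with _ | k
    · rw [funkHecke_succ_zero hn]; simp
    · have h3 := funkHecke_succ_succ hn j k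
      have h4 : (0 : ℝ) < 2 * k + n := by positivity
      have h5 : c = (2 * k + n : ℝ)⁻¹ := by rw [hc]; push_cast; ring_nf
      rw [eq_div_of_mul_eq h4.ne' h3, h5, Nat.add_sub_cancel]
      push_cast
      field_simp
      ring

theorem planeWave_smul {n : ℕ} (r : ℝ) (θ ω : Sph n) :
    planeWave (r • (θ : EuclideanSpace ℝ (Fin n))) ω = Complex.exp (-(Complex.I * r) *
      (inner ℝ (θ : EuclideanSpace ℝ (Fin n)) (ω : EuclideanSpace ℝ (Fin n)) : ℝ)) := by
  rw [planeWave, inner_smul_left]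
  congr 1
  simp
  ring

/-- Only `j = k + 2m` contributes; `j!` cancels, and `(-ir)^{k+2m} = (-i)^k r^k (-r²)^m` turns the
sum into the Bessel series. -/
theorem hasSum_radialBessel {n : ℕ} (hn : 2 ≤ n) (k : ℕ) (r : ℝ) :
    HasSum (fun j : ℕ => (-(Complex.I * r)) ^ j / (j.factorial : ℂ) * (funkHecke n j k : ℂ))
      ((-Complex.I) ^ k * (radialBessel n k r : ℂ)) := by
  have hinj : Function.Injective fun m : ℕ => k + 2 * m := fun a b h => by
    simp only at h; omega
  rw [← hinj.hasSum_iff]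
  · have h1 := (summable_besselSeries hn k (-(r ^ 2 / 4))).hasSum.mul_left ((r / 2) ^ k)
    have h2 := (Complex.hasSum_ofReal.2 h1).mul_left ((-Complex.I) ^ k)
    refine (congrArg (HasSum · _) (funext fun m => ?_)).mp h2
    simp only [Function.comp_apply, funkHecke_add_two_mul]
    push_cast
    have : ((k + 2 * m).factorial : ℂ) ≠ 0 := by exact_mod_cast Nat.factorial_ne_zero _
    have hI : (-(Complex.I * r)) ^ (k + 2 * m) =
        (-Complex.I) ^ k * ((r : ℂ) ^ k * (-(r : ℂ) ^ 2) ^ m) := by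
      rw [← neg_mul, mul_pow, pow_add, pow_add (r : ℂ), pow_mul, pow_mul, neg_sq, Complex.I_sq,
        neg_pow ((r : ℂ) ^ 2)]
      ring
    rw [hI, pow_add, pow_mul, show -((r : ℂ) ^ 2 / 4) = (-(r : ℂ) ^ 2) / 2 ^ 2 by ring, div_pow,
      div_pow]
    field_simp
  · intro j hj
    rw [funkHecke_eq_zero fun m hm => hj ⟨m, hm.symm⟩]
    simp

/-- The Fourier transform of a spherical harmonic. -/
theorem integral_planeWave_mul {n k : ℕ} (hn : 2 ≤ n) {p : MvPolynomial (Fin n) ℝ}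
    (h : IsSolidHarmonic k p) (r : ℝ) (θ : Sph n) :
    ∫ ω : Sph n, planeWave (r • (θ : EuclideanSpace ℝ (Fin n))) ω * evalSph p ω ∂(surf n) =
      sphArea n * ((-Complex.I) ^ k * (radialBessel n k r : ℂ)) * evalSph p θ := by
  set F : ℕ → Sph n → ℂ := fun j ω => (-(Complex.I * r)) ^ j / (j.factorial : ℂ) *
    (((inner ℝ (θ : EuclideanSpace ℝ (Fin n)) (ω : EuclideanSpace ℝ (Fin n))) ^ j *
      evalSph p ω : ℝ) : ℂ) with hF
  have hcont : ∀ j, Continuous fun ω : Sph n =>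
      (inner ℝ (θ : EuclideanSpace ℝ (Fin n)) (ω : EuclideanSpace ℝ (Fin n))) ^ j *
      evalSph p ω := fun j => by
    have := continuous_evalSph p
    fun_prop
  have hFc : ∀ j, Integrable (F j) (surf n) := fun j => integrable_of_continuous
    (continuous_const.mul (Complex.continuous_ofReal.comp (hcont j)))
  obtain ⟨M, hM⟩ := isCompact_univ.exists_bound_of_continuousOn (continuous_evalSph p).continuousOn
  have hin : ∀ ω : Sph n,
      |inner ℝ (θ : EuclideanSpace ℝ (Fin n)) (ω : EuclideanSpace ℝ (Fin n))| ≤ 1 := fun ω => by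
    have := abs_real_inner_le_norm (θ : EuclideanSpace ℝ (Fin n)) (ω : EuclideanSpace ℝ (Fin n))
    simpa [norm_eq_of_mem_sphere] using this
  have hFle : ∀ j ω, ‖F j ω‖ ≤ |r| ^ j / j.factorial * M := fun j ω => by
    have h1 := hM ω (mem_univ _)
    rw [Real.norm_eq_abs] at h1
    simp only [hF, norm_mul, norm_div, norm_pow, norm_neg, Complex.norm_I, one_mul,
      Complex.norm_real, Complex.norm_natCast, Real.norm_eq_abs]
    refine mul_le_mul_of_nonneg_left ?_ (by positivity)
    exact (mul_le_of_le_one_left (abs_nonneg _) (pow_le_one₀ (abs_nonneg _) (hin ω))).trans h1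
  -- Sum and integral may be exchanged because `|θ·ω| ≤ 1` bounds the terms by those of `e^{|r|}`
  -- times a constant.
  have hsum : Summable fun j => ∫ ω, ‖F j ω‖ ∂(surf n) := by
    refine .of_nonneg_of_le (fun j => integral_nonneg fun _ => norm_nonneg _) (fun j => ?_)
      ((Real.summable_pow_div_factorial |r|).mul_right (M * (surf n).real univ))
    refine (integral_mono (hFc j).norm (integrable_const _) (hFle j)).trans_eq ?_
    rw [integral_const, smul_eq_mul]; ring
  have key := hasSum_integral_of_summable_integral_norm hFc hsum
  have hpt : ∀ ω, ∑' j, F j ω =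
      planeWave (r • (θ : EuclideanSpace ℝ (Fin n))) ω * evalSph p ω := fun ω => by
    rw [planeWave_smul]
    have h1 := (NormedSpace.expSeries_div_hasSum_exp (𝔸 := ℂ) (-(Complex.I * r) *
      (inner ℝ (θ : EuclideanSpace ℝ (Fin n)) (ω : EuclideanSpace ℝ (Fin n)) : ℝ))).mul_right
      (evalSph p ω : ℂ)
    rw [← Complex.exp_eq_exp_ℂ] at h1
    rw [← h1.tsum_eq]
    refine tsum_congr fun j => ?_
    simp only [hF]
    push_cast
    rw [mul_pow]
    ring
  have hterm : ∀ j, ∫ ω, F j ω ∂(surf n) = (-(Complex.I * r)) ^ j / (j.factorial : ℂ) *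
      (funkHecke n j k : ℂ) * (sphArea n * evalSph p θ) := fun j => by
    simp only [hF]
    rw [integral_const_mul, integral_complex_ofReal, integral_inner_pow_mul hn j h θ]
    push_cast
    ring
  simp only [hpt, hterm] at key
  rw [key.unique ((hasSum_radialBessel hn k r).mul_right _)]
  ring

/-! ### Completeness of the spherical harmonics in `L²`. -/

/-- The class in `L²(S^{n-1})` of the restriction of a real polynomial. -/
def polyL2 {n : ℕ} (p : MvPolynomial (Fin n) ℝ) : L2Sph n :=
  ContinuousMap.toLp (E := ℂ) 2 (surf n) ℂ
    ⟨fun ω => (evalSph p ω : ℂ), Complex.continuous_ofReal.comp (continuous_evalSph p)⟩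

theorem coeFn_polyL2 {n : ℕ} (p : MvPolynomial (Fin n) ℝ) :
    polyL2 p =ᵐ[surf n] fun ω => (evalSph p ω : ℂ) :=
  ContinuousMap.coeFn_toLp (p := 2) (𝕜 := ℂ) (surf n) _

theorem inner_polyL2_left {n : ℕ} (p : MvPolynomial (Fin n) ℝ) (f : L2Sph n) :
    inner ℂ (polyL2 p) f = ∫ ω, (evalSph p ω : ℂ) * f ω ∂(surf n) := by
  rw [L2.inner_def]
  refine integral_congr_ae ((coeFn_polyL2 p).mono fun ω hω => ?_)
  simp only [hω, RCLike.inner_apply, Complex.conj_ofReal, mul_comm]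

theorem polyL2_add {n : ℕ} (p q : MvPolynomial (Fin n) ℝ) :
    polyL2 (p + q) = polyL2 p + polyL2 q := by
  rw [polyL2, polyL2, polyL2, ← map_add]
  congr 1
  ext ω
  simp [evalSph]

theorem polyL2_smul {n : ℕ} (c : ℝ) (p : MvPolynomial (Fin n) ℝ) :
    polyL2 (c • p) = (c : ℂ) • polyL2 p := by
  rw [polyL2, polyL2, ← map_smul]
  congr 1
  ext ω
  simp [evalSph, smul_eval]

/-- The coordinate functions on the sphere. -/
def coordSph {n : ℕ} (i : Fin n) : C(Sph n, ℝ) :=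
  ⟨fun ω => (ω : EuclideanSpace ℝ (Fin n)) i,
    (EuclideanSpace.proj (𝕜 := ℝ) i).continuous.comp continuous_subtype_val⟩

theorem aeval_coordSph_apply {n : ℕ} (p : MvPolynomial (Fin n) ℝ) (ω : Sph n) :
    aeval (coordSph (n := n)) p ω = evalSph p ω := by
  induction p using MvPolynomial.induction_on with
  | C a => simp [evalSph]
  | add p q hp hq => simp [evalSph, hp, hq] at hp hq ⊢
  | mul_X p i hp =>
    rw [map_mul, ContinuousMap.mul_apply, hp, aeval_X]
    simp only [evalSph, map_mul, eval_X]
    rfl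

theorem topologicalClosure_range_aeval_coordSph (n : ℕ) :
    (aeval (coordSph (n := n)) : MvPolynomial (Fin n) ℝ →ₐ[ℝ] C(Sph n, ℝ)).range.topologicalClosure
      = ⊤ := by
  refine ContinuousMap.subalgebra_topologicalClosure_eq_top_of_separatesPoints _ fun x y hxy => ?_
  obtain ⟨i, hi⟩ : ∃ i, (x : EuclideanSpace ℝ (Fin n)) i ≠ (y : EuclideanSpace ℝ (Fin n)) i := by
    by_contra! h
    exact hxy (Subtype.ext (by ext i; exact h i))
  exact ⟨coordSph i, ⟨coordSph i, ⟨X i, by simp⟩, rfl⟩, hi⟩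

/-- Stone-Weierstrass makes polynomials dense in the real continuous functions, real and imaginary
parts give the complex ones, and these are dense in `L²`. -/
theorem eq_zero_of_inner_polyL2 {n : ℕ} {f : L2Sph n}
    (h : ∀ p : MvPolynomial (Fin n) ℝ, inner ℂ (polyL2 p) f = 0) : f = 0 := by
  set J : C(Sph n, ℝ) → L2Sph n := fun g => ContinuousMap.toLp (E := ℂ) 2 (surf n) ℂ
    ((⟨Complex.ofReal, Complex.continuous_ofReal⟩ : C(ℝ, ℂ)).comp g) with hJ
  have hJc : Continuous J :=
    (ContinuousMap.toLp (E := ℂ) 2 (surf n) ℂ).continuous.comp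
      (ContinuousMap.continuous_postcomp _)
  have hJ0 : ∀ g, inner ℂ (J g) f = 0 := by
    have hclosed : IsClosed {g | inner ℂ (J g) f = 0} :=
      isClosed_eq (hJc.inner continuous_const) continuous_const
    have hsub : (↑(aeval (coordSph (n := n)) :
        MvPolynomial (Fin n) ℝ →ₐ[ℝ] C(Sph n, ℝ)).range : Set C(Sph n, ℝ)) ⊆
        {g | inner ℂ (J g) f = 0} := by
      rintro _ ⟨p, rfl⟩
      have : J (aeval (coordSph (n := n)) p) = polyL2 p := by
        simp only [hJ, polyL2]
        congr 1
        ext ω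
        simp [aeval_coordSph_apply]
      simp only [AlgHom.toRingHom_eq_coe, RingHom.coe_coe, mem_ofPred_eq, this, h]
    intro g
    have hg : g ∈ (aeval (coordSph (n := n)) :
        MvPolynomial (Fin n) ℝ →ₐ[ℝ] C(Sph n, ℝ)).range.topologicalClosure := by
      rw [topologicalClosure_range_aeval_coordSph]; trivial
    exact closure_minimal hsub hclosed hg
  have hC : ∀ g : C(Sph n, ℂ), inner ℂ (ContinuousMap.toLp (E := ℂ) 2 (surf n) ℂ g) f = 0 := by
    intro g
    have : ContinuousMap.toLp (E := ℂ) 2 (surf n) ℂ g =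
        J ((⟨Complex.re, Complex.continuous_re⟩ : C(ℂ, ℝ)).comp g) +
        Complex.I • J ((⟨Complex.im, Complex.continuous_im⟩ : C(ℂ, ℝ)).comp g) := by
      simp only [hJ]
      rw [← map_smul, ← map_add]
      congr 1
      ext ω
      simp [mul_comm Complex.I, Complex.re_add_im]
    rw [this, inner_add_left, inner_smul_left, hJ0, hJ0]
    simp
  have hd := ContinuousMap.toLp_denseRange ℂ (surf n) ℂ (p := 2) (by simp)
  have hall : ∀ u : L2Sph n, inner ℂ u f = 0 := by
    intro u
    refine hd.induction_on (p := fun u => inner ℂ u f = 0) u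
      (isClosed_eq (continuous_id.inner continuous_const) continuous_const) hC
  exact inner_self_eq_zero.1 (hall f)

/-- An `L²` function orthogonal to all spherical harmonics vanishes. -/
theorem eq_zero_of_inner_harmonic {n : ℕ} (hn : 2 ≤ n) {f : L2Sph n}
    (h : ∀ k (p : MvPolynomial (Fin n) ℝ), IsSolidHarmonic k p → inner ℂ (polyL2 p) f = 0) :
    f = 0 := by
  refine eq_zero_of_inner_polyL2 fun p => ?_
  obtain ⟨q, hq, hpq⟩ := exists_mem_span_harmonic hn p
  have : polyL2 p = polyL2 q := by
    rw [polyL2, polyL2]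
    congr 1
    ext ω
    exact congrArg Complex.ofReal (hpq ω)
  rw [this]
  clear hpq this
  induction hq using Submodule.span_induction with
  | mem Y hY => exact h _ Y hY.choose_spec
  | zero =>
    have := polyL2_smul 0 (0 : MvPolynomial (Fin n) ℝ)
    rw [zero_smul, Complex.ofReal_zero, zero_smul] at this
    rw [this, inner_zero_left]
  | add a b _ _ ha hb => rw [polyL2_add, inner_add_left, ha, hb, add_zero]
  | smul c a _ ha => rw [polyL2_smul, inner_smul_left, ha, mul_zero]

/-! ### Spectral decomposition of the Laplace-Beltrami operator. -/

theorem inner_polyL2_shifted {n k : ℕ} {p : MvPolynomial (Fin n) ℝ} (h : IsSolidHarmonic k p)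
    {φ : EuclideanSpace ℝ (Fin n) → ℂ} (hφ : ContDiff ℝ ((⊤ : ℕ∞) : WithTop ℕ∞) φ) {lam : ℝ}
    {u : L2Sph n} (hu : ⇑u =ᵐ[surf n] fun ω => lapBeltrami φ (ω : EuclideanSpace ℝ (Fin n)) +
      (lam : ℂ) * φ ω) :
    inner ℂ (polyL2 p) u = (lam - eigval n k) * ∫ ω : Sph n, φ ω * polyFun p ω ∂(surf n) := by
  rw [inner_polyL2_left, ← integral_shifted_mul_polyFun h hφ]
  refine integral_congr_ae (hu.mono fun ω hω => ?_)
  simp only [hω, polyFun_eq_evalSph, mul_comm]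

theorem polyL2_mem_eigenspace {n k : ℕ} {p : MvPolynomial (Fin n) ℝ} (h : IsSolidHarmonic k p) :
    polyL2 p ∈ eigenspace n (eigval n k) := by
  have hle : Submodule.span ℂ (shiftedRange n (eigval n k)) ≤ (ℂ ∙ polyL2 p)ᗮ := by
    rw [Submodule.span_le]
    rintro u ⟨φ, hφ, hu⟩
    rw [SetLike.mem_coe, Submodule.mem_orthogonal_singleton_iff_inner_right,
      inner_polyL2_shifted h hφ hu, sub_self, zero_mul]
  rw [eigenspace, Submodule.mem_orthogonal]
  intro u hu
  have := hle hu
  rwa [Submodule.mem_orthogonal_singleton_iff_inner_left] at this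

/-- The multiple `(lam - λ_k) Y` is itself `Δ_ω Y + lam Y`, hence orthogonal to the weak eigenspace
for `lam`. -/
theorem inner_polyL2_eq_zero {n k : ℕ} {p : MvPolynomial (Fin n) ℝ} (h : IsSolidHarmonic k p)
    {lam : ℝ} (hlam : lam ≠ eigval n k) {f : L2Sph n} (hf : f ∈ eigenspace n lam) :
    inner ℂ (polyL2 p) f = 0 := by
  have hmem : ((lam : ℂ) - eigval n k) • polyL2 p ∈ shiftedRange n lam := by
    refine ⟨polyFun p, contDiff_polyFun p, ?_⟩
    filter_upwards [Lp.coeFn_smul ((lam : ℂ) - eigval n k) (polyL2 p), coeFn_polyL2 p] with ω h1 h2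
    rw [h1, Pi.smul_apply, h2, lapBeltrami_polyFun h, polyFun_eq_evalSph, smul_eq_mul]
    ring
  have h0 := (Submodule.mem_orthogonal _ _).1 hf _ (Submodule.subset_span hmem)
  rw [inner_smul_left] at h0
  refine (mul_eq_zero.1 h0).resolve_left ?_
  refine (map_ne_zero _).2 ?_
  rw [← Complex.ofReal_sub]
  exact Complex.ofReal_ne_zero.2 (sub_ne_zero.2 hlam)

theorem inner_proj_left {n : ℕ} (lam : ℝ) (f g : L2Sph n) :
    inner ℂ (proj n lam f) g = inner ℂ f (proj n lam g) :=
  Submodule.inner_starProjection_left_eq_right _ f g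

theorem proj_mem {n : ℕ} (lam : ℝ) (f : L2Sph n) : proj n lam f ∈ eigenspace n lam :=
  Submodule.starProjection_apply_mem _ f

theorem proj_eq_self {n : ℕ} {lam : ℝ} {f : L2Sph n} (hf : f ∈ eigenspace n lam) :
    proj n lam f = f := Submodule.starProjection_eq_self_iff.2 hf

theorem inner_polyL2_proj_self {n k : ℕ} {p : MvPolynomial (Fin n) ℝ} (h : IsSolidHarmonic k p)
    (f : L2Sph n) : inner ℂ (polyL2 p) (proj n (eigval n k) f) = inner ℂ (polyL2 p) f := by
  rw [← inner_proj_left, proj_eq_self (polyL2_mem_eigenspace h)]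

/-- Orthogonality of weak eigenspaces, tested on harmonics only: a harmonic is orthogonal to one of
the two eigenspaces because its eigenvalue differs from `lam` or from `mu`. No description of the
eigenspaces is needed. -/
theorem proj_eq_zero_of_mem {n : ℕ} (hn : 2 ≤ n) {lam mu : ℝ} (hne : lam ≠ mu) {g : L2Sph n}
    (hg : g ∈ eigenspace n mu) : proj n lam g = 0 := by
  refine eq_zero_of_inner_harmonic hn fun k p hp => ?_
  by_cases hk : lam = eigval n k
  · rw [hk, inner_polyL2_proj_self hp]
    exact inner_polyL2_eq_zero hp (hk ▸ hne.symm) hg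
  · exact inner_polyL2_eq_zero hp hk (proj_mem _ _)

theorem proj_eq_zero {n : ℕ} (hn : 2 ≤ n) {lam : ℝ} (hlam : ∀ k, lam ≠ eigval n k)
    (f : L2Sph n) : proj n lam f = 0 :=
  eq_zero_of_inner_harmonic hn fun k _ hp => inner_polyL2_eq_zero hp (hlam k) (proj_mem _ _)

theorem orthogonalFamily_eigenspace {n : ℕ} (hn : 2 ≤ n) :
    OrthogonalFamily ℂ (fun k => eigenspace n (eigval n k))
      fun k => (eigenspace n (eigval n k)).subtypeₗᵢ := by
  intro j k hjk v w
  have h := proj_eq_zero_of_mem hn ((eigval_injective hn).ne hjk) w.2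
  change inner ℂ (v : L2Sph n) (w : L2Sph n) = 0
  rw [← proj_eq_self v.2, inner_proj_left, h, inner_zero_right]

instance completeSpace_eigenspace (n : ℕ) (lam : ℝ) : CompleteSpace (eigenspace n lam) :=
  (Submodule.isClosed_orthogonal _).completeSpace_coe

/-- The eigenspaces contain all harmonics, so nothing but `0` is orthogonal to all of them. -/
theorem isHilbertSum_eigenspace {n : ℕ} (hn : 2 ≤ n) :
    IsHilbertSum ℂ (fun k => eigenspace n (eigval n k))
      fun k => (eigenspace n (eigval n k)).subtypeₗᵢ := by
  refine IsHilbertSum.mkInternal (F := fun k => eigenspace n (eigval n k))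
    (orthogonalFamily_eigenspace hn) (top_le_iff.2 ?_)
  rw [Submodule.topologicalClosure_eq_top_iff, Submodule.eq_bot_iff]
  intro f hf
  refine eq_zero_of_inner_harmonic hn fun k p hp => ?_
  exact (Submodule.mem_orthogonal _ _).1 hf _
    (Submodule.mem_iSup_of_mem k (polyL2_mem_eigenspace hp))

theorem hasSum_proj {n : ℕ} (hn : 2 ≤ n) (f : L2Sph n) :
    HasSum (fun k => proj n (eigval n k) f) f := by
  have hV := isHilbertSum_eigenspace hn
  have h := hV.hasSum_linearIsometryEquiv_symm (hV.linearIsometryEquiv f)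
  rw [LinearIsometryEquiv.symm_apply_apply] at h
  have h2 : ∀ j, proj n (eigval n j) f = (hV.linearIsometryEquiv f j : L2Sph n) := fun j => by
    have h3 := h.mapL (proj n (eigval n j))
    refine h3.unique ?_
    convert hasSum_ite_eq j (hV.linearIsometryEquiv f j : L2Sph n) using 2 with k
    split_ifs with hkj
    · subst hkj; exact proj_eq_self (hV.linearIsometryEquiv f k).2
    · exact proj_eq_zero_of_mem hn ((eigval_injective hn).ne (Ne.symm hkj))
        (hV.linearIsometryEquiv f k).2
  simp only [h2]
  exact h

theorem hasSum_norm_sq_proj {n : ℕ} (hn : 2 ≤ n) (f : L2Sph n) :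
    HasSum (fun k => ‖proj n (eigval n k) f‖ ^ 2) (‖f‖ ^ 2) := by
  have h := (hasSum_proj hn f).mapL (innerSL ℂ f)
  have h2 := h.mapL Complex.reCLM
  simp only [innerSL_apply_apply, Complex.reCLM_apply] at h2
  have e1 : (inner ℂ f f).re = ‖f‖ ^ 2 := by
    rw [inner_self_eq_norm_sq_to_K]; norm_cast
  have e2 : ∀ k, (inner ℂ f (proj n (eigval n k) f)).re = ‖proj n (eigval n k) f‖ ^ 2 := fun k => by
    rw [← proj_eq_self (proj_mem (eigval n k) f), ← inner_proj_left,
      proj_eq_self (proj_mem (eigval n k) f), inner_self_eq_norm_sq_to_K]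
    norm_cast
  simpa only [e1, e2] using h2

/-! ### Powers of `Λ_ω` and Sobolev norms as sums over degrees. -/

/-- The eigenvalues as nonnegative reals. -/
def eigvalNN {n : ℕ} (hn : 2 ≤ n) (k : ℕ) : ℝ≥0 := ⟨eigval n k, eigval_nonneg hn k⟩

theorem eigvalNN_injective {n : ℕ} (hn : 2 ≤ n) : Function.Injective (eigvalNN hn) := fun _ _ h =>
  eigval_injective hn (congrArg NNReal.toReal h)

theorem proj_eq_zero_of_notMem_range {n : ℕ} (hn : 2 ≤ n) {lam : ℝ≥0}
    (h : lam ∉ range (eigvalNN hn)) (f : L2Sph n) : proj n lam f = 0 :=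
  proj_eq_zero hn (fun k hk => h ⟨k, NNReal.coe_injective hk.symm⟩) f

/-- The defining sum runs over all `lam ≥ 0`, but the projections vanish off the injective sequence
of eigenvalues. -/
theorem mem_angDomain_iff {n : ℕ} (hn : 2 ≤ n) (s : ℝ) (f : L2Sph n) :
    f ∈ angDomain n s ↔
      Summable fun k => (1 + eigval n k) ^ s * ‖proj n (eigval n k) f‖ ^ 2 := by
  rw [angDomain, mem_ofPred_eq, ← (eigvalNN_injective hn).summable_iff]
  · rfl
  · intro lam hlam
    simp [proj_eq_zero_of_notMem_range hn hlam]

theorem hasSum_angPow {n : ℕ} (hn : 2 ≤ n) {s : ℝ} {f : L2Sph n} (hf : f ∈ angDomain n s) :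
    HasSum (fun k => (((1 + eigval n k) ^ (s / 2) : ℝ) : ℂ) • proj n (eigval n k) f)
      (angPow n s f) := by
  have hs : Summable fun k =>
      (((1 + eigval n k) ^ (s / 2) : ℝ) : ℂ) • proj n (eigval n k) f := by
    have hmem : ∀ k, (((1 + eigval n k) ^ (s / 2) : ℝ) : ℂ) • proj n (eigval n k) f ∈
        eigenspace n (eigval n k) := fun k => Submodule.smul_mem _ _ (proj_mem _ _)
    refine ((orthogonalFamily_eigenspace hn).summable_iff_norm_sq_summable
      fun k => ⟨_, hmem k⟩).2 ?_
    refine ((mem_angDomain_iff hn s f).1 hf).congr fun k => ?_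
    have h0 : 0 ≤ 1 + eigval n k := by linarith [eigval_nonneg hn k]
    rw [Submodule.coe_norm, norm_smul, mul_pow, Complex.norm_real, Real.norm_of_nonneg (by positivity),
      ← Real.rpow_natCast ((1 + eigval n k) ^ (s / 2)), ← Real.rpow_mul h0]
    congr 2
    push_cast; ring
  have h2 : angPow n s f = ∑' k, (((1 + eigval n k) ^ (s / 2) : ℝ) : ℂ) • proj n (eigval n k) f := by
    rw [angPow, ← (eigvalNN_injective hn).tsum_eq]
    · rfl
    · intro lam hlam
      by_contra h
      exact hlam (by simp [proj_eq_zero_of_notMem_range hn h])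
  rw [h2]
  exact hs.hasSum

theorem proj_angPow {n : ℕ} (hn : 2 ≤ n) {s : ℝ} {f : L2Sph n} (hf : f ∈ angDomain n s) (j : ℕ) :
    proj n (eigval n j) (angPow n s f) =
      (((1 + eigval n j) ^ (s / 2) : ℝ) : ℂ) • proj n (eigval n j) f := by
  refine ((hasSum_angPow hn hf).mapL (proj n (eigval n j))).unique ?_
  convert hasSum_ite_eq j ((((1 + eigval n j) ^ (s / 2) : ℝ) : ℂ) • proj n (eigval n j) f)
    using 2 with k
  split_ifs with hkj
  · subst hkj; rw [map_smul, proj_eq_self (proj_mem _ _)]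
  · rw [map_smul, proj_eq_zero_of_mem hn ((eigval_injective hn).ne (Ne.symm hkj)) (proj_mem _ _),
      smul_zero]

theorem enorm_sq_eq_tsum {n : ℕ} (hn : 2 ≤ n) (f : L2Sph n) :
    ‖f‖ₑ ^ 2 = ∑' k, ‖proj n (eigval n k) f‖ₑ ^ 2 := by
  have h := hasSum_norm_sq_proj hn f
  rw [← ofReal_norm, ← ENNReal.ofReal_pow (norm_nonneg _), ← h.tsum_eq,
    ENNReal.ofReal_tsum_of_nonneg (fun k => by positivity) h.summable]
  exact tsum_congr fun k => by rw [ENNReal.ofReal_pow (norm_nonneg _), ofReal_norm]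

/-- The square of the Sobolev norm as a sum over the degrees of the spherical harmonics. -/
theorem sobNorm_sq {n : ℕ} (hn : 2 ≤ n) (s : ℝ) (f : L2Sph n) :
    sobNorm n s f ^ 2 =
      ∑' k, ENNReal.ofReal ((1 + eigval n k) ^ s) * ‖proj n (eigval n k) f‖ₑ ^ 2 := by
  have h0 : ∀ k, 0 ≤ 1 + eigval n k := fun k => by linarith [eigval_nonneg hn k]
  rw [sobNorm]
  split_ifs with hf
  · rw [enorm_sq_eq_tsum hn]
    refine tsum_congr fun k => ?_
    rw [proj_angPow hn hf, enorm_smul, mul_pow]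
    congr 1
    have := h0 k
    rw [← ofReal_norm, Complex.norm_real, Real.norm_of_nonneg (by positivity),
      ← ENNReal.ofReal_pow (by positivity), ← Real.rpow_natCast ((1 + eigval n k) ^ (s / 2)),
      ← Real.rpow_mul (h0 k)]
    congr 2
    push_cast; ring
  -- Outside the domain the sum must be infinite, since a finite one would give the summability
  -- defining the domain.
  · rw [ENNReal.top_pow two_ne_zero]
    symm
    by_contra hne
    refine hf ((mem_angDomain_iff hn s f).2 ?_)
    refine (ENNReal.summable_toReal hne).congr fun k => ?_
    have := h0 k
    rw [ENNReal.toReal_mul, ENNReal.toReal_ofReal (by positivity), ENNReal.toReal_pow,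
      toReal_enorm]

theorem sobNorm_zero_right {n : ℕ} (hn : 2 ≤ n) (f : L2Sph n) : sobNorm n 0 f = ‖f‖ₑ := by
  have h := sobNorm_sq hn 0 f
  simp only [Real.rpow_zero, ENNReal.ofReal_one, one_mul] at h
  rw [← enorm_sq_eq_tsum hn] at h
  exact (ENNReal.pow_right_strictMono two_ne_zero).injective h

/-! ### Diagonalization of the Fourier transform of `g dσ`. -/

theorem continuous_planeWave {n : ℕ} :
    Continuous fun q : EuclideanSpace ℝ (Fin n) × Sph n => planeWave q.1 q.2 := by
  unfold planeWave
  fun_prop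

theorem norm_planeWave {n : ℕ} (x : EuclideanSpace ℝ (Fin n)) (ω : Sph n) :
    ‖planeWave x ω‖ = 1 := by
  rw [planeWave, Complex.norm_exp]
  simp

theorem planeWave_smul_comm {n : ℕ} (r : ℝ) (θ ω : Sph n) :
    planeWave (r • (θ : EuclideanSpace ℝ (Fin n))) ω =
      planeWave (r • (ω : EuclideanSpace ℝ (Fin n))) θ := by
  rw [planeWave_smul, planeWave_smul, real_inner_comm]

theorem integrable_L2Sph {n : ℕ} (g : L2Sph n) : Integrable g (surf n) :=
  (Lp.memLp g).integrable one_le_two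

theorem continuous_fourierSurf {n : ℕ} (g : L2Sph n) : Continuous (fourierSurf g) := by
  unfold fourierSurf
  refine continuous_of_dominated (bound := fun ω => ‖g ω‖) (fun x => ?_) (fun x => ?_)
    (integrable_L2Sph g).norm (Eventually.of_forall fun ω => ?_)
  · exact (continuous_planeWave.comp (by fun_prop : Continuous fun ω : Sph n =>
      (x, ω))).aestronglyMeasurable.mul (Lp.aestronglyMeasurable g)
  · exact Eventually.of_forall fun ω => by rw [norm_mul, norm_planeWave, one_mul]
  · exact (continuous_planeWave.comp (by fun_prop : Continuous
      fun x : EuclideanSpace ℝ (Fin n) => (x, ω))).mul continuous_const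

/-- The restriction of the Fourier transform of `g dσ` to the sphere of radius `r`, as an element
of `L²(S^{n-1})`. -/
def fourierSph {n : ℕ} (r : ℝ) (g : L2Sph n) : L2Sph n :=
  ContinuousMap.toLp (E := ℂ) 2 (surf n) ℂ
    ⟨fun θ => fourierSurf g (r • (θ : EuclideanSpace ℝ (Fin n))),
      (continuous_fourierSurf g).comp (by fun_prop)⟩

theorem coeFn_fourierSph {n : ℕ} (r : ℝ) (g : L2Sph n) :
    fourierSph r g =ᵐ[surf n] fun θ => fourierSurf g (r • (θ : EuclideanSpace ℝ (Fin n))) :=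
  ContinuousMap.coeFn_toLp (p := 2) (𝕜 := ℂ) (surf n) _

/-- Fubini, together with the symmetry of the kernel `e^{-ir θ·ω}` in `θ` and `ω`, moves the
transform from `g` onto the harmonic. -/
theorem inner_polyL2_fourierSph {n k : ℕ} (hn : 2 ≤ n) {p : MvPolynomial (Fin n) ℝ}
    (h : IsSolidHarmonic k p) (r : ℝ) (g : L2Sph n) :
    inner ℂ (polyL2 p) (fourierSph r g) =
      sphArea n * ((-Complex.I) ^ k * (radialBessel n k r : ℂ)) * inner ℂ (polyL2 p) g := by
  have hint : Integrable (Function.uncurry fun θ ω : Sph n => (evalSph p θ : ℂ) *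
      planeWave (r • (θ : EuclideanSpace ℝ (Fin n))) ω * g ω) ((surf n).prod (surf n)) := by
    have hc : Continuous fun q : Sph n × Sph n => (evalSph p q.1 : ℂ) *
        planeWave (r • (q.1 : EuclideanSpace ℝ (Fin n))) q.2 := by
      have h1 := continuous_evalSph p
      unfold planeWave
      fun_prop
    obtain ⟨M, hM⟩ := isCompact_univ.exists_bound_of_continuousOn hc.continuousOn
    have h2 : Integrable (fun q : Sph n × Sph n => g q.2) ((surf n).prod (surf n)) :=
      (integrable_L2Sph g).comp_snd (surf n)
    have h3 : Integrable (fun q : Sph n × Sph n => (evalSph p q.1 : ℂ) *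
        planeWave (r • (q.1 : EuclideanSpace ℝ (Fin n))) q.2 * g q.2)
        ((surf n).prod (surf n)) := h2.bdd_mul (c := M) hc.aestronglyMeasurable
          (Eventually.of_forall fun q => hM q (mem_univ q))
    exact h3
  rw [inner_polyL2_left, inner_polyL2_left, ← integral_const_mul]
  calc ∫ θ, (evalSph p θ : ℂ) * fourierSph r g θ ∂(surf n)
      = ∫ θ, ∫ ω, (evalSph p θ : ℂ) * planeWave (r • (θ : EuclideanSpace ℝ (Fin n))) ω * g ω
          ∂(surf n) ∂(surf n) := by
        refine integral_congr_ae ((coeFn_fourierSph r g).mono fun θ hθ => ?_)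
        simp only [hθ, fourierSurf, mul_assoc]
        rw [integral_const_mul]
    _ = ∫ ω, ∫ θ, (evalSph p θ : ℂ) * planeWave (r • (θ : EuclideanSpace ℝ (Fin n))) ω * g ω
          ∂(surf n) ∂(surf n) := integral_integral_swap hint
    _ = _ := by
        refine integral_congr_ae (Eventually.of_forall fun ω => ?_)
        simp only
        rw [integral_mul_const]
        simp only [planeWave_smul_comm r _ ω, mul_comm (evalSph p _ : ℂ)]
        rw [integral_planeWave_mul hn h r ω]
        ring

/-- The Fourier transform acts on the spherical harmonics of degree `k` as a scalar. -/
theorem proj_fourierSph {n : ℕ} (hn : 2 ≤ n) (r : ℝ) (g : L2Sph n) (k : ℕ) :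
    proj n (eigval n k) (fourierSph r g) =
      (sphArea n * ((-Complex.I) ^ k * (radialBessel n k r : ℂ))) • proj n (eigval n k) g := by
  rw [← sub_eq_zero]
  refine eq_zero_of_inner_harmonic hn fun l p hp => ?_
  by_cases hl : l = k
  · subst hl
    rw [inner_sub_right, inner_smul_right, inner_polyL2_proj_self hp, inner_polyL2_proj_self hp,
      inner_polyL2_fourierSph hn hp, sub_self]
  · exact inner_polyL2_eq_zero hp ((eigval_injective hn).ne (Ne.symm hl))
      (sub_mem (proj_mem _ _) (Submodule.smul_mem _ _ (proj_mem _ _)))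

theorem continuous_weighted_smul {n : ℕ} (b r : ℝ) (g : L2Sph n) :
    Continuous fun ω : Sph n => weighted b (fourierSurf g) (r • (ω : EuclideanSpace ℝ (Fin n))) := by
  have h : (fun ω : Sph n => weighted b (fourierSurf g) (r • (ω : EuclideanSpace ℝ (Fin n)))) =
      fun ω : Sph n => ((|r| ^ (-b / 2) : ℝ) : ℂ) *
        fourierSurf g (r • (ω : EuclideanSpace ℝ (Fin n))) := by
    funext ω
    rw [weighted, norm_smul, norm_eq_of_mem_sphere, mul_one, Real.norm_eq_abs]
  rw [h]
  exact continuous_const.mul ((continuous_fourierSurf g).comp (by fun_prop))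

theorem memLp_weighted_smul {n : ℕ} (b r : ℝ) (g : L2Sph n) :
    MemLp (fun ω : Sph n => weighted b (fourierSurf g) (r • (ω : EuclideanSpace ℝ (Fin n)))) 2
      (surf n) := by
  have hc := continuous_weighted_smul b r g
  obtain ⟨M, hM⟩ := isCompact_univ.exists_bound_of_continuousOn hc.continuousOn
  exact MemLp.of_bound hc.aestronglyMeasurable M (Eventually.of_forall fun ω => hM ω (mem_univ ω))

theorem toLp_weighted_smul {n : ℕ} (b : ℝ) {r : ℝ} (hr : 0 < r) (g : L2Sph n) :
    (memLp_weighted_smul b r g).toLp _ = ((r ^ (-b / 2) : ℝ) : ℂ) • fourierSph r g := by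
  refine Lp.ext ?_
  filter_upwards [(memLp_weighted_smul b r g).coeFn_toLp, coeFn_fourierSph r g,
    Lp.coeFn_smul ((r ^ (-b / 2) : ℝ) : ℂ) (fourierSph r g)] with ω h1 h2 h3
  rw [h1, h3, Pi.smul_apply, h2, weighted, norm_smul, norm_eq_of_mem_sphere, mul_one,
    Real.norm_of_nonneg hr.le, smul_eq_mul]

theorem sobNormFun_weighted_sq {n : ℕ} (hn : 2 ≤ n) (s b : ℝ) {r : ℝ} (hr : 0 < r) (g : L2Sph n) :
    sobNormFun n s (fun ω : Sph n =>
        weighted b (fourierSurf g) (r • (ω : EuclideanSpace ℝ (Fin n)))) ^ 2 =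
      ∑' k, ENNReal.ofReal ((1 + eigval n k) ^ s) *
        (ENNReal.ofReal (sphArea n ^ 2) * ENNReal.ofReal (r ^ (-b) * radialBessel n k r ^ 2) *
          ‖proj n (eigval n k) g‖ₑ ^ 2) := by
  rw [sobNormFun, dif_pos (memLp_weighted_smul b r g), toLp_weighted_smul b hr, sobNorm_sq hn]
  refine tsum_congr fun k => ?_
  congr 1
  rw [map_smul, proj_fourierSph hn, enorm_smul, enorm_smul, mul_pow, mul_pow, ← mul_assoc]
  congr 1
  have h1 : ∀ z : ℂ, ‖z‖ₑ ^ 2 = ENNReal.ofReal (‖z‖ ^ 2) := fun z => by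
    rw [ENNReal.ofReal_pow (norm_nonneg _), ofReal_norm]
  rw [h1, h1, ← ENNReal.ofReal_mul (by positivity), ← ENNReal.ofReal_mul (by positivity)]
  congr 1
  simp only [norm_mul, norm_pow, norm_neg, Complex.norm_I, one_pow, one_mul, Complex.norm_real,
    Real.norm_eq_abs, mul_pow, sq_abs]
  rw [← Real.rpow_natCast (r ^ (-b / 2)), ← Real.rpow_mul hr.le]
  rw [show -b / 2 * ((2 : ℕ) : ℝ) = -b by push_cast; ring]
  ring

theorem sq_rpow_half (a : ℝ≥0∞) : (a ^ (1 / 2 : ℝ)) ^ 2 = a := by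
  rw [← ENNReal.rpow_natCast, ← ENNReal.rpow_mul]
  norm_num

theorem rpow_neg_mul_pow {n : ℕ} (hn : 2 ≤ n) (b : ℝ) {r : ℝ} (hr : 0 < r) :
    r ^ (-b) * r ^ (n - 1) = r ^ ((n : ℝ) - 1 - b) := by
  rw [← Real.rpow_natCast r (n - 1), ← Real.rpow_add hr, Nat.cast_sub (by omega)]
  congr 1
  push_cast; ring

/-- The angular Sobolev norm of the weighted Fourier transform, diagonalized in spherical
harmonics. -/
theorem angL2Norm_weighted_sq {n : ℕ} (hn : 2 ≤ n) (s b : ℝ) (g : L2Sph n) :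
    angL2Norm n s (weighted b (fourierSurf g)) ^ 2 =
      ENNReal.ofReal (sphArea n ^ 2) * ∑' k, ENNReal.ofReal ((1 + eigval n k) ^ s) *
        besselMoment n b k * ‖proj n (eigval n k) g‖ₑ ^ 2 := by
  rw [angL2Norm, sq_rpow_half]
  have h1 : ∀ r ∈ Ioi (0 : ℝ), sobNormFun n s (fun ω : Sph n =>
        weighted b (fourierSurf g) (r • (ω : EuclideanSpace ℝ (Fin n)))) ^ 2 *
        ENNReal.ofReal (r ^ (n - 1)) =
      ∑' k, (ENNReal.ofReal (sphArea n ^ 2) * (ENNReal.ofReal ((1 + eigval n k) ^ s) *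
        ‖proj n (eigval n k) g‖ₑ ^ 2)) *
          ENNReal.ofReal (r ^ ((n : ℝ) - 1 - b) * radialBessel n k r ^ 2) := by
    intro r hr
    have hr0 : 0 < r := hr
    rw [sobNormFun_weighted_sq hn s b hr0, ← ENNReal.tsum_mul_right]
    refine tsum_congr fun k => ?_
    rw [← rpow_neg_mul_pow hn b hr0, mul_right_comm (r ^ (-b)),
      ENNReal.ofReal_mul (p := r ^ (-b) * radialBessel n k r ^ 2) (by positivity)]
    ring
  -- Tonelli: all terms are nonnegative, so the identity also holds when the moments are infinite,
  -- as necessity requires.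
  rw [setLIntegral_congr_fun measurableSet_Ioi h1, lintegral_tsum]
  · rw [← ENNReal.tsum_mul_left]
    refine tsum_congr fun k => ?_
    rw [lintegral_const_mul _ (measurable_besselMoment_integrand hn b k).ennreal_ofReal, besselMoment]
    ring
  · exact fun k => ((measurable_besselMoment_integrand hn b k).ennreal_ofReal.const_mul _).aemeasurable

/-! ### The plain `L²` norm in polar coordinates. -/

/-- Integration in polar coordinates. -/
theorem lintegral_polar {n : ℕ} (hn : 2 ≤ n) {f : EuclideanSpace ℝ (Fin n) → ℝ≥0∞}
    (hf : Measurable f) :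
    ∫⁻ x, f x = ∫⁻ r in Ioi (0 : ℝ),
      (∫⁻ ω : Sph n, f (r • (ω : EuclideanSpace ℝ (Fin n))) ∂(surf n)) *
        ENNReal.ofReal (r ^ (n - 1)) := by
  have : Nonempty (Fin n) := ⟨⟨0, by omega⟩⟩
  have hmp := (volume : Measure (EuclideanSpace ℝ (Fin n))).measurePreserving_homeomorphUnitSphereProd
  rw [finrank_euclideanSpace_fin] at hmp
  have hf2 : Measurable fun q : Sph n × Ioi (0 : ℝ) =>
      f ((q.2 : ℝ) • (q.1 : EuclideanSpace ℝ (Fin n))) := hf.comp (by fun_prop)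
  calc ∫⁻ x, f x = ∫⁻ x : ({0}ᶜ : Set (EuclideanSpace ℝ (Fin n))), f x ∂(volume.comap Subtype.val) := by
        rw [lintegral_subtype_comap (measurableSet_singleton _).compl, restrict_compl_singleton]
    _ = ∫⁻ q, f ((q.2 : ℝ) • (q.1 : EuclideanSpace ℝ (Fin n)))
          ∂((surf n).prod (Measure.volumeIoiPow (n - 1))) := by
        rw [← hmp.lintegral_comp hf2]
        refine lintegral_congr fun x => ?_
        have hx : (x : EuclideanSpace ℝ (Fin n)) ≠ 0 := x.2
        simp [smul_smul, hx]
    _ = ∫⁻ r, ∫⁻ ω, f ((r : ℝ) • (ω : EuclideanSpace ℝ (Fin n))) ∂(surf n)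
          ∂(Measure.volumeIoiPow (n - 1)) := lintegral_prod_symm _ hf2.aemeasurable
    _ = _ := by
        rw [Measure.volumeIoiPow, lintegral_withDensity_eq_lintegral_mul _ (by fun_prop)
          hf2.lintegral_prod_left']
        rw [← lintegral_subtype_comap measurableSet_Ioi]
        exact lintegral_congr fun r => mul_comm _ _

theorem measurable_weighted {n : ℕ} (b : ℝ) (g : L2Sph n) :
    Measurable (weighted b (fourierSurf g)) :=
  (Complex.measurable_ofReal.comp (measurable_norm.pow_const _)).mul
    (continuous_fourierSurf g).measurable

theorem eLpNorm_two_sq {α : Type*} [MeasurableSpace α] (μ : Measure α) (f : α → ℂ) :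
    eLpNorm f 2 μ ^ 2 = ∫⁻ x, ‖f x‖ₑ ^ 2 ∂μ := by
  rw [eLpNorm_eq_lintegral_rpow_enorm_toReal two_ne_zero ENNReal.ofNat_ne_top, ENNReal.toReal_ofNat,
    sq_rpow_half]
  simp

/-- Identifies the norm of the second estimate with the case `s = 0` of the angular norm, so that
the same diagonal formula serves both. -/
theorem eLpNorm_weighted_eq_angL2Norm {n : ℕ} (hn : 2 ≤ n) (b : ℝ) (g : L2Sph n) :
    eLpNorm (weighted b (fourierSurf g)) 2 volume = angL2Norm n 0 (weighted b (fourierSurf g)) := by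
  refine (ENNReal.pow_right_strictMono two_ne_zero).injective ?_
  rw [eLpNorm_two_sq, lintegral_polar hn ((measurable_weighted b g).enorm.pow_const 2), angL2Norm,
    sq_rpow_half]
  refine setLIntegral_congr_fun measurableSet_Ioi fun r _ => ?_
  congr 1
  rw [sobNormFun, dif_pos (memLp_weighted_smul b r g), sobNorm_zero_right hn, Lp.enorm_toLp,
    eLpNorm_two_sq]

theorem eLpNorm_weighted_sq {n : ℕ} (hn : 2 ≤ n) (b : ℝ) (g : L2Sph n) :
    eLpNorm (weighted b (fourierSurf g)) 2 volume ^ 2 =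
      ENNReal.ofReal (sphArea n ^ 2) *
        ∑' k, besselMoment n b k * ‖proj n (eigval n k) g‖ₑ ^ 2 := by
  rw [eLpNorm_weighted_eq_angL2Norm hn, angL2Norm_weighted_sq hn]
  simp

/-! ### Distributional data `Λ_ω^{-s} h`. -/

theorem inner_star_left {n : ℕ} (u v : L2Sph n) :
    inner ℂ (star u) v = ∫ ω, u ω * v ω ∂(surf n) := by
  rw [L2.inner_def]
  refine integral_congr_ae ((Lp.coeFn_star u).mono fun ω hω => ?_)
  simp only [hω, RCLike.inner_apply, Pi.star_apply, RCLike.star_def, Complex.conj_conj, mul_comm]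

theorem inner_star_comm {n : ℕ} (u v : L2Sph n) : inner ℂ (star u) v = inner ℂ (star v) u := by
  rw [inner_star_left, inner_star_left]
  simp only [mul_comm]

theorem inner_polyL2_star {n : ℕ} (p : MvPolynomial (Fin n) ℝ) (f : L2Sph n) :
    inner ℂ (polyL2 p) (star f) = (starRingEnd ℂ) (inner ℂ (polyL2 p) f) := by
  rw [inner_polyL2_left, inner_polyL2_left, ← integral_conj]
  refine integral_congr_ae ((Lp.coeFn_star f).mono fun ω hω => ?_)
  simp [hω]

/-- The harmonics used as tests are real, so conjugation respects the eigenspaces. This makes the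
projections symmetric for the bilinear pairing `∫ u v dσ` in the definition of the Fourier
transform. -/
theorem proj_star {n : ℕ} (hn : 2 ≤ n) (k : ℕ) (f : L2Sph n) :
    proj n (eigval n k) (star f) = star (proj n (eigval n k) f) := by
  rw [← sub_eq_zero]
  refine eq_zero_of_inner_harmonic hn fun l p hp => ?_
  rw [inner_sub_right, inner_polyL2_star]
  by_cases hl : l = k
  · subst hl
    rw [inner_polyL2_proj_self hp, inner_polyL2_proj_self hp, inner_polyL2_star, sub_self]
  · have hne := (eigval_injective hn).ne (Ne.symm hl)
    rw [inner_polyL2_eq_zero hp hne (proj_mem _ _), inner_polyL2_eq_zero hp hne (proj_mem _ _),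
      map_zero, sub_zero]

theorem fourierSurf_eq_inner {n : ℕ} (g : L2Sph n) (x : EuclideanSpace ℝ (Fin n)) :
    fourierSurf g x = inner ℂ (star (planeWaveL2 x)) g := by
  rw [inner_star_left, fourierSurf]
  refine integral_congr_ae ((memLp_planeWave x).coeFn_toLp.mono fun ω hω => ?_)
  simp only [planeWaveL2, hω]

theorem fourierSurfSob_eq_inner {n : ℕ} (s : ℝ) (h : L2Sph n) (x : EuclideanSpace ℝ (Fin n)) :
    fourierSurfSob s h x = inner ℂ (star h) (angPow n (-s) (planeWaveL2 x)) := by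
  rw [inner_star_comm, inner_star_left, fourierSurfSob]

/-- The class in `L²(S^{n-1})` of the restriction of a smooth function. -/
def smoothL2 {n : ℕ} {φ : EuclideanSpace ℝ (Fin n) → ℂ}
    (hφ : ContDiff ℝ ((⊤ : ℕ∞) : WithTop ℕ∞) φ) : L2Sph n :=
  ContinuousMap.toLp (E := ℂ) 2 (surf n) ℂ
    ⟨fun ω => φ ω, hφ.continuous.comp continuous_subtype_val⟩

theorem coeFn_smoothL2 {n : ℕ} {φ : EuclideanSpace ℝ (Fin n) → ℂ}
    (hφ : ContDiff ℝ ((⊤ : ℕ∞) : WithTop ℕ∞) φ) :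
    smoothL2 hφ =ᵐ[surf n] fun ω => φ ω :=
  ContinuousMap.coeFn_toLp (p := 2) (𝕜 := ℂ) (surf n) _

theorem contDiff_one_sub_lapBeltrami {n : ℕ} {φ : EuclideanSpace ℝ (Fin n) → ℂ}
    (hφ : ContDiff ℝ ((⊤ : ℕ∞) : WithTop ℕ∞) φ) :
    ContDiff ℝ ((⊤ : ℕ∞) : WithTop ℕ∞) (fun x => φ x - lapBeltrami φ x) :=
  hφ.sub (contDiff_lapBeltrami hφ)

/-- The difference of the two sides is the projection of `Δ_ω φ + lam φ`, which is orthogonal to the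
eigenspace by definition. -/
theorem proj_smoothL2_one_sub_lapBeltrami {n : ℕ} {φ : EuclideanSpace ℝ (Fin n) → ℂ}
    (hφ : ContDiff ℝ ((⊤ : ℕ∞) : WithTop ℕ∞) φ) (lam : ℝ) :
    proj n lam (smoothL2 (contDiff_one_sub_lapBeltrami hφ)) =
      (1 + lam : ℂ) • proj n lam (smoothL2 hφ) := by
  set u : L2Sph n := (1 + lam : ℂ) • smoothL2 hφ - smoothL2 (contDiff_one_sub_lapBeltrami hφ)
    with hu
  have hmem : u ∈ shiftedRange n lam := by
    refine ⟨φ, hφ, ?_⟩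
    filter_upwards [Lp.coeFn_sub ((1 + lam : ℂ) • smoothL2 hφ)
        (smoothL2 (contDiff_one_sub_lapBeltrami hφ)), Lp.coeFn_smul (1 + lam : ℂ) (smoothL2 hφ),
      coeFn_smoothL2 hφ, coeFn_smoothL2 (contDiff_one_sub_lapBeltrami hφ)] with ω h1 h2 h3 h4
    rw [hu, h1, Pi.sub_apply, h2, Pi.smul_apply, h3, h4, smul_eq_mul]
    ring
  have h0 : proj n lam u = 0 := by
    refine (inner_self_eq_zero (𝕜 := ℂ)).1 ?_
    rw [inner_proj_left, proj_eq_self (proj_mem _ _)]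
    exact (Submodule.mem_orthogonal _ _).1 (proj_mem lam u) _ (Submodule.subset_span hmem)
  rw [hu, map_sub, map_smul, sub_eq_zero] at h0
  exact h0.symm

/-- Smooth functions are in the domain of every power of `Λ_ω`. -/
theorem smoothL2_mem_angDomain {n : ℕ} (hn : 2 ≤ n) (s : ℝ)
    {φ : EuclideanSpace ℝ (Fin n) → ℂ} (hφ : ContDiff ℝ ((⊤ : ℕ∞) : WithTop ℕ∞) φ) :
    smoothL2 hφ ∈ angDomain n s := by
  -- Each application of `1 - Δ_ω` multiplies the component of degree `k` by `1 + λ_k`, so this is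
  -- Bessel summability for `(1 - Δ_ω)^N φ`.
  have hN : ∀ N : ℕ, ∀ {φ : EuclideanSpace ℝ (Fin n) → ℂ}
      (hφ : ContDiff ℝ ((⊤ : ℕ∞) : WithTop ℕ∞) φ),
      Summable fun k => (1 + eigval n k) ^ (2 * N) * ‖proj n (eigval n k) (smoothL2 hφ)‖ ^ 2 := by
    intro N
    induction N with
    | zero => intro φ hφ; simpa using (hasSum_norm_sq_proj hn (smoothL2 hφ)).summable
    | succ N ih =>
      intro φ hφ
      refine (ih (contDiff_one_sub_lapBeltrami hφ)).congr fun k => ?_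
      have h0 : 0 ≤ 1 + eigval n k := by linarith [eigval_nonneg hn k]
      have h1 : ‖(1 + eigval n k : ℂ)‖ = 1 + eigval n k := by
        rw [← Complex.ofReal_one, ← Complex.ofReal_add, Complex.norm_real, Real.norm_of_nonneg h0]
      rw [proj_smoothL2_one_sub_lapBeltrami hφ, norm_smul, h1]
      ring
  obtain ⟨N, hsN⟩ := exists_nat_ge s
  rw [mem_angDomain_iff hn]
  refine (hN N hφ).of_nonneg_of_le (fun k => ?_) fun k => ?_
  · have := eigval_nonneg hn k
    positivity
  · have h1 : 1 ≤ 1 + eigval n k := by linarith [eigval_nonneg hn k]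
    refine mul_le_mul_of_nonneg_right ?_ (by positivity)
    rw [← Real.rpow_natCast]
    refine Real.rpow_le_rpow_of_exponent_le h1 (hsN.trans ?_)
    push_cast
    linarith [(Nat.cast_nonneg N : (0 : ℝ) ≤ N)]

theorem planeWaveL2_mem_angDomain {n : ℕ} (hn : 2 ≤ n) (s : ℝ) (x : EuclideanSpace ℝ (Fin n)) :
    planeWaveL2 x ∈ angDomain n s := by
  have hφ : ContDiff ℝ ((⊤ : ℕ∞) : WithTop ℕ∞) (fun y : EuclideanSpace ℝ (Fin n) =>
      Complex.exp (-(Complex.I * ((inner ℝ x y : ℝ) : ℂ)))) :=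
    ((contDiff_const.mul (Complex.ofRealCLM.contDiff.comp
      (contDiff_const.inner ℝ contDiff_id))).neg).cexp
  exact smoothL2_mem_angDomain hn s hφ

/-- The partial sums of `Λ_ω^{-s} h`. -/
def angPowPartial (n : ℕ) (s : ℝ) (h : L2Sph n) (K : ℕ) : L2Sph n :=
  ∑ k ∈ Finset.range K, (((1 + eigval n k) ^ (-s / 2) : ℝ) : ℂ) • proj n (eigval n k) h

/-- The spectral series of `Λ_ω^{-s} e_x` converges in `L²`; pairing it with `h` and moving each
projection onto `h` gives the transforms of the truncations. -/
theorem tendsto_fourierSurf_angPowPartial {n : ℕ} (hn : 2 ≤ n) (s : ℝ) (h : L2Sph n)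
    (x : EuclideanSpace ℝ (Fin n)) :
    Tendsto (fun K => fourierSurf (angPowPartial n s h K) x) atTop
      (𝓝 (fourierSurfSob s h x)) := by
  have h1 := (hasSum_angPow hn (planeWaveL2_mem_angDomain hn (-s) x)).mapL (innerSL ℂ (star h))
  rw [fourierSurfSob_eq_inner]
  refine h1.tendsto_sum_nat.congr fun K => ?_
  rw [fourierSurf_eq_inner, angPowPartial, inner_sum]
  refine Finset.sum_congr rfl fun k _ => ?_
  rw [innerSL_apply_apply, inner_smul_right, inner_smul_right, ← inner_proj_left, proj_star hn,
    inner_star_comm]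

theorem sobNorm_angPowPartial_le {n : ℕ} (hn : 2 ≤ n) (s : ℝ) (h : L2Sph n) (K : ℕ) :
    sobNorm n s (angPowPartial n s h K) ≤ ‖h‖ₑ := by
  rw [← (ENNReal.pow_right_strictMono two_ne_zero).le_iff_le]
  rw [sobNorm_sq hn, enorm_sq_eq_tsum hn]
  refine ENNReal.tsum_le_tsum fun j => ?_
  have h0 : 0 < 1 + eigval n j := by linarith [eigval_nonneg hn j]
  have hp : proj n (eigval n j) (angPowPartial n s h K) =
      if j ∈ Finset.range K then
        (((1 + eigval n j) ^ (-s / 2) : ℝ) : ℂ) • proj n (eigval n j) h else 0 := by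
    rw [angPowPartial, map_sum, ← Finset.sum_ite_eq' (Finset.range K) j fun k =>
      (((1 + eigval n k) ^ (-s / 2) : ℝ) : ℂ) • proj n (eigval n k) h]
    refine Finset.sum_congr rfl fun k _ => ?_
    split_ifs with hkj
    · subst hkj; rw [map_smul, proj_eq_self (proj_mem _ _)]
    · rw [map_smul, proj_eq_zero_of_mem hn ((eigval_injective hn).ne (Ne.symm hkj)) (proj_mem _ _),
        smul_zero]
  rw [hp]
  split_ifs
  · rw [enorm_smul, mul_pow, ← mul_assoc, ← ofReal_norm (((1 + eigval n j) ^ (-s / 2) : ℝ) : ℂ),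
      Complex.norm_real, Real.norm_of_nonneg (by positivity), ← ENNReal.ofReal_pow (by positivity),
      ← ENNReal.ofReal_mul (by positivity), ← Real.rpow_natCast ((1 + eigval n j) ^ (-s / 2)),
      ← Real.rpow_mul h0.le, ← Real.rpow_add h0]
    have : s + -s / 2 * ((2 : ℕ) : ℝ) = 0 := by push_cast; ring
    rw [this, Real.rpow_zero, ENNReal.ofReal_one, one_mul]
  · simp

/-- Fatou's lemma along the truncations, which lie in `L²` and have `H^s` norm at most `‖h‖`. -/
theorem eLpNorm_weighted_fourierSurfSob_le {n : ℕ} (hn : 2 ≤ n) (b s : ℝ) {C : ℝ≥0∞}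
    (hC : ∀ g : L2Sph n, eLpNorm (weighted b (fourierSurf g)) 2 volume ≤ C * sobNorm n s g)
    (h : L2Sph n) : eLpNorm (weighted b (fourierSurfSob s h)) 2 volume ≤ C * ‖h‖ₑ := by
  refine (Lp.eLpNorm_lim_le_liminf_eLpNorm
    (f := fun K => weighted b (fourierSurf (angPowPartial n s h K)))
    (fun K => (measurable_weighted b _).aestronglyMeasurable) _
    (Eventually.of_forall fun x =>
      (tendsto_fourierSurf_angPowPartial hn s h x).const_mul _)).trans ?_
  refine liminf_le_of_frequently_le' (Frequently.of_forall fun K => ?_)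
  exact (hC _).trans (mul_le_mul_right (sobNorm_angPowPartial_le hn s h K) C)

/-! ### Test functions for the necessity of `1 < b < n`. -/

theorem polyL2_ne_zero {n : ℕ} {p : MvPolynomial (Fin n) ℝ} {ω : Sph n} (h : evalSph p ω ≠ 0) :
    polyL2 p ≠ 0 := by
  intro h0
  have h1 : (fun ω => (evalSph p ω : ℂ)) =ᵐ[surf n] fun _ => 0 := by
    refine (coeFn_polyL2 p).symm.trans ?_
    rw [h0]
    exact Lp.coeFn_zero ℂ 2 (surf n)
  have h2 := (Complex.continuous_ofReal.comp (continuous_evalSph p)).ae_eq_iff_eq (surf n)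
    continuous_const |>.1 h1
  exact h (Complex.ofReal_eq_zero.1 (congrFun h2 ω))

theorem exists_harmonic_ne_zero {n : ℕ} (hn : 2 ≤ n) {k : ℕ} (hk : k < 2) :
    ∃ p : MvPolynomial (Fin n) ℝ, IsSolidHarmonic k p ∧ polyL2 p ≠ 0 := by
  set i : Fin n := ⟨0, by omega⟩
  set ω : Sph n := ⟨EuclideanSpace.single i 1, by simp⟩
  interval_cases k
  · exact ⟨C 1, ⟨isHomogeneous_C _ _, by simp [polyLap]⟩,
      polyL2_ne_zero (ω := ω) (by simp [evalSph])⟩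
  · exact ⟨X i, ⟨isHomogeneous_X _ _, polyLap_X i⟩,
      polyL2_ne_zero (ω := ω) (by simp [evalSph, ω])⟩

theorem sobNorm_polyL2_ne_top {n k : ℕ} (hn : 2 ≤ n) {p : MvPolynomial (Fin n) ℝ}
    (h : IsSolidHarmonic k p) (s : ℝ) : sobNorm n s (polyL2 p) ≠ ⊤ := by
  have h1 := sobNorm_sq hn s (polyL2 p)
  rw [tsum_eq_single k fun j hj => by
    rw [proj_eq_zero_of_mem hn ((eigval_injective hn).ne hj) (polyL2_mem_eigenspace h)]
    simp] at h1
  intro htop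
  rw [htop, ENNReal.top_pow two_ne_zero] at h1
  exact ENNReal.mul_ne_top ENNReal.ofReal_ne_top (ENNReal.pow_ne_top enorm_ne_top) h1.symm

/-- An infinite moment of degree `k` enters the diagonal formula with a positive coefficient,
whatever `s` is. -/
theorem besselMoment_ne_top_of_angL2Norm {n k : ℕ} (hn : 2 ≤ n) {b s : ℝ}
    {p : MvPolynomial (Fin n) ℝ} (h : IsSolidHarmonic k p) (hp : polyL2 p ≠ 0)
    (hfin : angL2Norm n s (weighted b (fourierSurf (polyL2 p))) ≠ ⊤) :
    besselMoment n b k ≠ ⊤ := by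
  intro htop
  have h1 := angL2Norm_weighted_sq hn s b (polyL2 p)
  have h2 : ∑' j, ENNReal.ofReal ((1 + eigval n j) ^ s) * besselMoment n b j *
      ‖proj n (eigval n j) (polyL2 p)‖ₑ ^ 2 = ⊤ := by
    refine ENNReal.tsum_eq_top_of_eq_top ⟨k, ?_⟩
    have h0 : 0 < 1 + eigval n k := by linarith [eigval_nonneg hn k]
    rw [proj_eq_self (polyL2_mem_eigenspace h), htop, ENNReal.mul_top, ENNReal.top_mul]
    · exact pow_ne_zero 2 (enorm_ne_zero.2 hp)
    · exact (ENNReal.ofReal_pos.2 (by positivity)).ne'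
  have hσ := sphArea_pos hn
  rw [h2, ENNReal.mul_top (ENNReal.ofReal_pos.2 (by positivity)).ne'] at h1
  exact ENNReal.pow_ne_top hfin h1

theorem ofReal_sq {a : ℝ} (ha : 0 ≤ a) : ENNReal.ofReal (a ^ 2) = ENNReal.ofReal a ^ 2 :=
  ENNReal.ofReal_pow ha 2

end SphereTrace

end

/-! ### The theorem. -/

open SphereTrace MeasureTheory

theorem theorem1p1 (n : ℕ) (hn : 2 ≤ n) (b : ℝ) :
    -- the two-sided estimate
    (1 < b → b < n →
      ∃ c C : ℝ, 0 < c ∧ 0 < C ∧ ∀ g : SphereTrace.L2Sph n,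
        ENNReal.ofReal c * ‖g‖ₑ ≤
            SphereTrace.angL2Norm n ((b - 1) / 2)
              (SphereTrace.weighted b (SphereTrace.fourierSurf g)) ∧
          SphereTrace.angL2Norm n ((b - 1) / 2)
              (SphereTrace.weighted b (SphereTrace.fourierSurf g)) ≤
            ENNReal.ofReal C * ‖g‖ₑ) ∧
    -- the estimate by the Sobolev norm of `g`, for `g` in `L²` and for all `g = Λ_ω^{-s} h` in `H^s`
    (1 < b → b < n →
      ∃ C : ℝ, 0 < C ∧ ∀ s : ℝ, (1 - b) / 2 ≤ s →
        (∀ g : SphereTrace.L2Sph n,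
          MeasureTheory.eLpNorm (SphereTrace.weighted b (SphereTrace.fourierSurf g)) 2
              MeasureTheory.volume ≤
            ENNReal.ofReal C * SphereTrace.sobNorm n s g) ∧
        (∀ h : SphereTrace.L2Sph n,
          MeasureTheory.eLpNorm (SphereTrace.weighted b (SphereTrace.fourierSurfSob s h)) 2
              MeasureTheory.volume ≤
            ENNReal.ofReal C * ‖h‖ₑ)) ∧
    -- the range of `b` is necessary, in the first estimate and in the second for any `s`
    ((∃ C : ℝ, ∀ g : SphereTrace.L2Sph n,
        SphereTrace.angL2Norm n ((b - 1) / 2)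
            (SphereTrace.weighted b (SphereTrace.fourierSurf g)) ≤
          ENNReal.ofReal C * ‖g‖ₑ) → 1 < b ∧ b < n) ∧
    (∀ s : ℝ, (∃ C : ℝ, ∀ g : SphereTrace.L2Sph n,
        MeasureTheory.eLpNorm (SphereTrace.weighted b (SphereTrace.fourierSurf g)) 2
            MeasureTheory.volume ≤
          ENNReal.ofReal C * SphereTrace.sobNorm n s g) → 1 < b ∧ b < n) := by
  have hσ := sphArea_pos hn
  have hsq : ∀ {x y : ENNReal}, x ^ 2 ≤ y ^ 2 → x ≤ y := fun h =>
    (ENNReal.pow_right_strictMono two_ne_zero).le_iff_le.1 h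
  -- Finiteness on one nonzero harmonic of degree `0` and one of degree `1` already forces the range
  -- of `b`.
  have hnec : ∀ s : ℝ, (∀ k < 2, ∀ p : MvPolynomial (Fin n) ℝ, IsSolidHarmonic k p →
      angL2Norm n s (weighted b (fourierSurf (polyL2 p))) ≠ ⊤) → 1 < b ∧ b < n := by
    intro s h
    have hk : ∀ k < 2, besselMoment n b k ≠ ⊤ := fun k hk => by
      obtain ⟨p, hp, hp0⟩ := exists_harmonic_ne_zero hn hk
      exact besselMoment_ne_top_of_angL2Norm hn hp hp0 (h k hk p hp)
    exact ⟨lt_of_besselMoment_ne_top hn (hk 0 (by norm_num)) (hk 1 (by norm_num)),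
      lt_of_besselMoment_zero_ne_top hn (hk 0 (by norm_num))⟩
  refine ⟨fun hb1 hbn => ?_, fun hb1 hbn => ?_, fun ⟨C, hC⟩ => ?_, fun s ⟨C, hC⟩ => ?_⟩
  · obtain ⟨c, C, hc, hC, h⟩ := exists_besselMoment_bounds hn hb1 hbn
    refine ⟨sphArea n * √c, sphArea n * √C, by positivity, by positivity, fun g => ⟨hsq ?_, hsq ?_⟩⟩
    · rw [mul_pow, ← ofReal_sq (by positivity), mul_pow, Real.sq_sqrt hc.le,
        ENNReal.ofReal_mul (by positivity), mul_assoc, angL2Norm_weighted_sq hn, enorm_sq_eq_tsum hn,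
        ← ENNReal.tsum_mul_left (a := ENNReal.ofReal c)]
      gcongr with k
      exact (h k).1
    · rw [mul_pow, ← ofReal_sq (by positivity), mul_pow, Real.sq_sqrt hC.le,
        ENNReal.ofReal_mul (by positivity), mul_assoc, angL2Norm_weighted_sq hn, enorm_sq_eq_tsum hn,
        ← ENNReal.tsum_mul_left (a := ENNReal.ofReal C)]
      gcongr with k
      exact (h k).2
  · obtain ⟨c, C, hc, hC, h⟩ := exists_besselMoment_bounds hn hb1 hbn
    refine ⟨sphArea n * √C, by positivity, fun s hs => ?_⟩
    have key : ∀ g : L2Sph n, eLpNorm (weighted b (fourierSurf g)) 2 volume ≤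
        ENNReal.ofReal (sphArea n * √C) * sobNorm n s g := fun g => hsq <| by
      rw [mul_pow, ← ofReal_sq (by positivity), mul_pow, Real.sq_sqrt hC.le,
        ENNReal.ofReal_mul (by positivity), mul_assoc, eLpNorm_weighted_sq hn, sobNorm_sq hn,
        ← ENNReal.tsum_mul_left (a := ENNReal.ofReal C)]
      refine mul_le_mul' le_rfl (ENNReal.tsum_le_tsum fun k => ?_)
      rw [← mul_assoc]
      refine mul_le_mul' ?_ le_rfl
      have h1 : 1 ≤ 1 + eigval n k := by linarith [eigval_nonneg hn k]
      have h0 : 0 < 1 + eigval n k := by linarith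
      -- Since `1 + λ_k ≥ 1`, the power `(1-b)/2` may be raised to any larger `s` at no cost, so `C`
      -- does not depend on `s`.
      calc besselMoment n b k
          = ENNReal.ofReal ((1 + eigval n k) ^ ((1 - b) / 2)) *
            (ENNReal.ofReal ((1 + eigval n k) ^ ((b - 1) / 2)) * besselMoment n b k) := by
            rw [← mul_assoc, ← ENNReal.ofReal_mul (by positivity), ← Real.rpow_add h0,
              show (1 - b) / 2 + (b - 1) / 2 = 0 by ring, Real.rpow_zero, ENNReal.ofReal_one,
              one_mul]
        _ ≤ ENNReal.ofReal ((1 + eigval n k) ^ s) * ENNReal.ofReal C := by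
            gcongr
            exact (h k).2
        _ = _ := mul_comm _ _
    exact ⟨key, eLpNorm_weighted_fourierSurfSob_le hn b s key⟩
  · refine hnec _ fun k _ p _ => ne_top_of_le_ne_top ?_ (hC (polyL2 p))
    exact ENNReal.mul_ne_top ENNReal.ofReal_ne_top enorm_ne_top
  -- The left side is the angular norm with exponent `0`, whatever the `s` on the right, where the
  -- Sobolev norm of a harmonic is always finite.
  · refine hnec 0 fun k _ p hp => ?_
    rw [← eLpNorm_weighted_eq_angL2Norm hn]
    refine ne_top_of_le_ne_top ?_ (hC (polyL2 p))
    exact ENNReal.mul_ne_top ENNReal.ofReal_ne_top (sobNorm_polyL2_ne_top hn hp s)
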